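/- Let $G$ be a countable group. A length function on $G$ is a map $l:G\to[0,\infty)$ with $l(e)=0$, $l(g^{-1})=l(g)$ and $l(gh)\le l(g)+l(h)$. A function $f:\mathbb N\to[0,\infty)$ is subexponential if $\lim_{n\to\infty} f(n)^{1/n}=1$. The group $G$ has SD (subexponential decay) with respect to $l$ if there is a subexponential $f$ such that $\|x\|\le f(D)\,\|x\|_2$ for every $D\in\mathbb N$ and every $x\in\mathbb C[G]$ supported on $\{g: l(g)\le D\}$; here $\|x\|$ is the norm of $x$ as an operator on $\ell^2(G)$ in the left regular representation and $\|x\|_2=(\sum_g|x(g)|^2)^{1/2}$. The group $G$ has SD if it has SD with respect to some length function. Let $\Gamma=(V,E)$ be a finite simplicial graph, let $(G_v)_{v\in V}$ be groups, and let $G=G(\Gamma,G_v,v\in V)$ be their graph product: the quotient of the free product of the $G_v$ by the normal subgroup generated by the commutators $[a,b]$ with $a\in G_v$, $b\in G_w$ and $v,w$ adjacent. An expression $g=y_1\cdots y_k$ with $y_j\in G_{v_j}$ is reduced if $k$ is minimal among all expressions of $g$. **Theorem.** (1) If every vertex group $G_v$ has SD, then $G$ has SD. (2) Suppose that each $G_v$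 has SD with respect to a length function $l_v$ that is bounded below by a positive constant on $G_v\setminus\{e\}$ (for instance, an integer-valued length function vanishing only at $e$). Then $$l_G(g)=\sum_{j=1}^k l_{v_j}(y_j)\qquad(g=y_1\cdots y_k \text{ a reduced expression, } y_j\in G_{v_j})$$ is a well-defined length function on $G$, and $G$ has SD with respect to $l_G$. -/

import Mathlib

open scoped NNReal ENNReal
open Filter Topology

universe u v w

noncomputable section

namespace SubexpDecay

/-! ### The left regular representation and the two norms on `ℂ[G]` -/

/-- The Hilbert space `ℓ²(G)`. -/
abbrev L2 (G : Type u) : Type u := lp (fun _ : G => ℂ) 2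

theorem memLp_translate {G : Type u} [Group G] (g : G) (ξ : L2 G) :
    Memℓp (fun h : G => (ξ : G → ℂ) (g⁻¹ * h)) 2 := by
  have h2 : 0 < (2 : ℝ≥0∞).toReal := by norm_num
  exact (memℓp_gen_iff h2).2
    ((Equiv.mulLeft g⁻¹).summable_iff.2 ((memℓp_gen_iff h2).1 (lp.memℓp ξ)))

/-- Left translation `(λ(g) ξ)(h) = ξ(g⁻¹ h)` on `ℓ²(G)`, an isometry. -/
def leftTranslation {G : Type u} [Group G] (g : G) : L2 G →ₗᵢ[ℂ] L2 G where
  toFun ξ := ⟨fun h => (ξ : G → ℂ) (g⁻¹ * h), memLp_translate g ξ⟩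
  map_add' _ _ := rfl
  map_smul' _ _ := rfl
  norm_map' ξ := by
    have h2 : 0 < (2 : ℝ≥0∞).toReal := by norm_num
    rw [lp.norm_eq_tsum_rpow h2, lp.norm_eq_tsum_rpow h2]
    congr 1
    exact (Equiv.mulLeft g⁻¹).tsum_eq (fun h => ‖(ξ : G → ℂ) h‖ ^ (2 : ℝ≥0∞).toReal)

@[simp] theorem leftTranslation_apply {G : Type u} [Group G] (g : G) (ξ : L2 G) (h : G) :
    (leftTranslation g ξ : G → ℂ) h = (ξ : G → ℂ) (g⁻¹ * h) := rfl

/-- The operator `λ(x) = ∑ g, x(g) λ(g)` on `ℓ²(G)`, for `x ∈ ℂ[G]`. -/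
def regularRep {G : Type u} [Group G] (x : MonoidAlgebra ℂ G) : L2 G →L[ℂ] L2 G :=
  ∑ g ∈ x.coeff.support, x.coeff g • (leftTranslation g).toContinuousLinearMap

/-- The operator norm `‖x‖ = ‖λ(x)‖` of `x ∈ ℂ[G]`. -/
def opNorm {G : Type u} [Group G] (x : MonoidAlgebra ℂ G) : ℝ := ‖regularRep x‖

/-- The `2`-norm `‖x‖₂ = (∑ g, |x(g)|²) ^ (1/2)` of `x ∈ ℂ[G]`. -/
def twoNorm {G : Type u} (x : MonoidAlgebra ℂ G) : ℝ :=
  √(∑ g ∈ x.coeff.support, ‖x.coeff g‖ ^ 2)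

/-! ### Subexponential decay

A length function on `G` is a `GroupSeminorm G`: a function `l : G → ℝ` with `l 1 = 0`,
`l g⁻¹ = l g` and `l (g * h) ≤ l g + l h` (it is then automatically nonnegative). -/

/-- `f : ℕ → [0, ∞)` is subexponential if `f(n) ^ (1/n) → 1`. -/
def IsSubexponential (f : ℕ → ℝ≥0) : Prop :=
  Tendsto (fun n : ℕ => f n ^ (1 / (n : ℝ))) atTop (𝓝 1)

/-- `f` is a decay function for `(G, l)`: `‖x‖ ≤ f(D) ‖x‖₂` for every `x ∈ ℂ[G]` supported on the
`l`-ball of radius `D`. -/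
def IsDecayFunction {G : Type u} [Group G] (l : GroupSeminorm G) (f : ℕ → ℝ≥0) : Prop :=
  ∀ (D : ℕ) (x : MonoidAlgebra ℂ G), (∀ g ∈ x.coeff.support, l g ≤ D) →
    opNorm x ≤ f D * twoNorm x

/-- `G` is a countable group that has property SD with respect to the length function `l`. -/
def HasSDWith {G : Type u} [Group G] (l : GroupSeminorm G) : Prop :=
  Countable G ∧ ∃ f : ℕ → ℝ≥0, IsSubexponential f ∧ IsDecayFunction l f

/-- `G` is a countable group that has property SD. -/
def HasSD (G : Type u) [Group G] : Prop :=
  ∃ l : GroupSeminorm G, HasSDWith l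

/-! ### Graph products -/

/-- The commutators `a b a⁻¹ b⁻¹` in the free product, `a` and `b` in adjacent vertex groups. -/
def graphRelators {V : Type v} (Γ : SimpleGraph V) (G : V → Type w) [∀ i, Group (G i)] :
    Set (Monoid.CoprodI G) :=
  {r | ∃ (i j : V) (a : G i) (b : G j), Γ.Adj i j ∧
    r = Monoid.CoprodI.of a * Monoid.CoprodI.of b * (Monoid.CoprodI.of a)⁻¹ *
      (Monoid.CoprodI.of b)⁻¹}

/-- The graph product `G(Γ, G_v, v ∈ V)`: the quotient of the free product of the vertex groups in
which the groups of adjacent vertices commute. -/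
abbrev GraphProduct {V : Type v} (Γ : SimpleGraph V) (G : V → Type w) [∀ i, Group (G i)] :
    Type (max v w) :=
  Monoid.CoprodI G ⧸ Subgroup.normalClosure (graphRelators Γ G)

/-- The canonical map of a vertex group to the graph product. -/
def GraphProduct.of {V : Type v} (Γ : SimpleGraph V) {G : V → Type w} [∀ i, Group (G i)] (i : V) :
    G i →* GraphProduct Γ G :=
  (QuotientGroup.mk' (Subgroup.normalClosure (graphRelators Γ G))).comp Monoid.CoprodI.of

/-- The element `y₁ ⋯ y_k` of the graph product given by an expression, that is, a finite
sequence of syllables `y_j`, each in a vertex group `G_{v_j}`. -/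
def GraphProduct.eval {V : Type v} (Γ : SimpleGraph V) {G : V → Type w} [∀ i, Group (G i)]
    (e : List (Σ i, G i)) : GraphProduct Γ G :=
  (e.map fun y => GraphProduct.of Γ y.1 y.2).prod

/-- An expression is reduced if no expression of the same element has fewer syllables. -/
def GraphProduct.IsReduced {V : Type v} (Γ : SimpleGraph V) {G : V → Type w} [∀ i, Group (G i)]
    (e : List (Σ i, G i)) : Prop :=
  ∀ e' : List (Σ i, G i), GraphProduct.eval Γ e' = GraphProduct.eval Γ e → e.length ≤ e'.length

end SubexpDecay

end

/-! Two facts about words carry the proof. First, irreducible expressions of the same element differ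
only by shuffles, because the graph product acts on irreducible expressions modulo shuffling
(`shuffle_of_eval_eq`). This makes the summed length well defined.

Second, every product `g h` has controlled cancellation: `g = a s c`, `h = c⁻¹ t b` and `g h = a (s
t) b`, where `s` and `t` lie in the product of the vertex groups of a clique and all three products
are irreducible (`exists_cancellation`, `exists_splitting`). Once the clique and the number of
syllables of the left factor at each vertex are fixed, an element has at most one such splitting
(`IsSplitting.unique`).

Decay is then an estimate of the trilinear form `∑ x(g) ξ(h) η(g h)` on nonnegative functions. The
pairs `(g, h)` are sorted by the clique and the two syllable counts. For a fixed type, the inner sum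
over `s, t` is a convolution in the direct product of the vertex groups, bounded by the product of
their constants (`ConvolutionBound.pi`). The remaining sum over `a, b, c` is bounded by
Cauchy-Schwarz (`tsum_triangle_le`), and uniqueness bounds the resulting norms by those of `x`, `ξ`,
`η`. The number of types is polynomial in the number of syllables of `g`, which is linear in the
radius when nontrivial syllables have length bounded below; so the total constant is subexponential.

For the first claim, every `l_v` is increased by `1` off the identity. This shrinks balls, so it
preserves decay, and it provides the lower bound. -/

noncomputable section

namespace SubexpDecay

set_option linter.unusedSectionVars false

namespace GraphProduct

/-! ### Irreducible expressions and shuffles. -/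

section Words

variable {V : Type v} (Γ : SimpleGraph V) {G : V → Type w} [∀ i, Group (G i)]

theorem eval_nil : eval Γ ([] : List (Σ i, G i)) = 1 := rfl

theorem eval_cons (y : Σ i, G i) (e : List (Σ i, G i)) :
    eval Γ (y :: e) = of Γ y.1 y.2 * eval Γ e := by
  simp [eval]

theorem eval_append (e f : List (Σ i, G i)) : eval Γ (e ++ f) = eval Γ e * eval Γ f := by
  simp [eval]

theorem commute_of {i j : V} (h : Γ.Adj i j) (a : G i) (b : G j) :
    of Γ i a * of Γ j b = of Γ j b * of Γ i a := by
  have key : (QuotientGroup.mk' (Subgroup.normalClosure (graphRelators Γ G)))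
      (Monoid.CoprodI.of a * Monoid.CoprodI.of b * (Monoid.CoprodI.of a)⁻¹ *
        (Monoid.CoprodI.of b)⁻¹) = 1 :=
    (QuotientGroup.eq_one_iff _).2 (Subgroup.subset_normalClosure ⟨i, j, a, b, h, rfl⟩)
  simp only [map_mul, map_inv] at key
  exact mul_inv_eq_iff_eq_mul.1 (mul_inv_eq_one.1 key) |>.trans rfl

open Classical in
/-- The front `v`-syllable of an expression: the first `v`-syllable, if everything before it is
adjacent to `v`, and `1` if there is no such syllable. -/
def head (v : V) : List (Σ i, G i) → G v
  | [] => 1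
  | y :: e => if h : y.1 = v then h ▸ y.2 else if Γ.Adj y.1 v then head v e else 1

open Classical in
/-- The expression with its front `v`-syllable deleted. -/
def tail (v : V) : List (Σ i, G i) → List (Σ i, G i)
  | [] => []
  | y :: e => if y.1 = v then e else if Γ.Adj y.1 v then y :: tail v e else y :: e

@[simp] theorem head_nil (v : V) : head Γ v ([] : List (Σ i, G i)) = 1 := rfl

@[simp] theorem tail_nil (v : V) : tail Γ v ([] : List (Σ i, G i)) = [] := rfl

@[simp] theorem head_cons_self (v : V) (a : G v) (e : List (Σ i, G i)) :
    head Γ v (⟨v, a⟩ :: e) = a := by simp [head]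

@[simp] theorem tail_cons_self (v : V) (a : G v) (e : List (Σ i, G i)) :
    tail Γ v (⟨v, a⟩ :: e) = e := by simp [tail]

theorem head_cons_adj {v : V} {y : Σ i, G i} (h : Γ.Adj y.1 v) (e : List (Σ i, G i)) :
    head Γ v (y :: e) = head Γ v e := by simp [head, h, h.ne]

theorem tail_cons_adj {v : V} {y : Σ i, G i} (h : Γ.Adj y.1 v) (e : List (Σ i, G i)) :
    tail Γ v (y :: e) = y :: tail Γ v e := by simp [tail, h, h.ne]

theorem head_cons_not_adj {v : V} {y : Σ i, G i} (h : y.1 ≠ v) (h' : ¬ Γ.Adj y.1 v)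
    (e : List (Σ i, G i)) : head Γ v (y :: e) = 1 := by simp [head, h, h']

theorem tail_cons_not_adj {v : V} {y : Σ i, G i} (h : y.1 ≠ v) (h' : ¬ Γ.Adj y.1 v)
    (e : List (Σ i, G i)) : tail Γ v (y :: e) = y :: e := by simp [tail, h, h']

/-- An expression is irreducible if its syllables are nontrivial and no two of them can be
merged after shuffling. -/
def Irred : List (Σ i, G i) → Prop
  | [] => True
  | y :: e => y.2 ≠ 1 ∧ head Γ y.1 e = 1 ∧ Irred e

/-- Two expressions are shuffles of each other if they differ by exchanges of consecutive
syllables in adjacent vertex groups. -/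
inductive Shuffle : List (Σ i, G i) → List (Σ i, G i) → Prop
  | nil : Shuffle [] []
  | cons (y : Σ i, G i) {e f : List (Σ i, G i)} : Shuffle e f → Shuffle (y :: e) (y :: f)
  | swap {y z : Σ i, G i} (e : List (Σ i, G i)) : Γ.Adj y.1 z.1 →
      Shuffle (y :: z :: e) (z :: y :: e)
  | trans {e f g : List (Σ i, G i)} : Shuffle e f → Shuffle f g → Shuffle e g

variable {Γ}

theorem Shuffle.refl : ∀ e : List (Σ i, G i), Shuffle Γ e e
  | [] => .nil
  | y :: e => .cons y (Shuffle.refl e)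

theorem Shuffle.symm {e f : List (Σ i, G i)} (h : Shuffle Γ e f) : Shuffle Γ f e := by
  induction h with
  | nil => exact .nil
  | cons y _ ih => exact .cons y ih
  | swap e h => exact .swap e h.symm
  | trans _ _ h₁ h₂ => exact h₂.trans h₁

theorem Shuffle.append_left (p : List (Σ i, G i)) {e f : List (Σ i, G i)} (h : Shuffle Γ e f) :
    Shuffle Γ (p ++ e) (p ++ f) := by
  induction p with
  | nil => exact h
  | cons y p ih => exact .cons y ih

theorem Shuffle.cons_append {y : Σ i, G i} {x : List (Σ i, G i)}
    (h : ∀ z ∈ x, Γ.Adj z.1 y.1) (e : List (Σ i, G i)) :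
    Shuffle Γ (y :: (x ++ e)) (x ++ y :: e) := by
  induction x with
  | nil => exact Shuffle.refl _
  | cons z x ih =>
    exact (Shuffle.swap _ (h z (by simp)).symm).trans
      (.cons z (ih fun t ht => h t (by simp [ht])))

theorem Shuffle.perm {e f : List (Σ i, G i)} (h : Shuffle Γ e f) : e.Perm f := by
  induction h with
  | nil => exact .nil
  | cons y _ ih => exact ih.cons y
  | swap e h => exact .swap _ _ _
  | trans _ _ h₁ h₂ => exact h₁.trans h₂

theorem Shuffle.eval_eq {e f : List (Σ i, G i)} (h : Shuffle Γ e f) :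
    eval Γ e = eval Γ f := by
  induction h with
  | nil => rfl
  | cons y _ ih => rw [eval_cons, eval_cons, ih]
  | swap e h =>
    simp only [eval_cons, ← mul_assoc]
    rw [commute_of Γ h]
  | trans _ _ h₁ h₂ => exact h₁.trans h₂

theorem Shuffle.head_eq {e f : List (Σ i, G i)} (h : Shuffle Γ e f) (v : V) :
    head Γ v e = head Γ v f := by
  induction h with
  | nil => rfl
  | cons y _ ih => simp only [head, ih]
  | @swap y z e h =>
    obtain ⟨i, a⟩ := y
    obtain ⟨j, b⟩ := z
    simp only at h
    by_cases hi : i = v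
    · subst hi
      rw [head_cons_self, head_cons_adj Γ h.symm, head_cons_self]
    by_cases hj : j = v
    · subst hj
      rw [head_cons_self, head_cons_adj Γ h, head_cons_self]
    simp only [head, hi, hj, dite_false]
    split_ifs <;> rfl
  | trans _ _ h₁ h₂ => exact h₁.trans h₂

theorem Shuffle.tail {e f : List (Σ i, G i)} (h : Shuffle Γ e f) (v : V) :
    Shuffle Γ (tail Γ v e) (tail Γ v f) := by
  induction h with
  | nil => exact .nil
  | cons y h ih =>
    simp only [GraphProduct.tail]
    split_ifs
    exacts [h, .cons y ih, .cons y h]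
  | @swap y z e h =>
    obtain ⟨i, a⟩ := y
    obtain ⟨j, b⟩ := z
    simp only at h
    by_cases hi : i = v
    · subst hi
      rw [tail_cons_self, tail_cons_adj Γ h.symm, tail_cons_self]
      exact .refl _
    by_cases hj : j = v
    · subst hj
      rw [tail_cons_self, tail_cons_adj Γ h, tail_cons_self]
      exact .refl _
    simp only [GraphProduct.tail, hi, hj, if_false]
    split_ifs <;> exact .swap _ h
  | trans _ _ h₁ h₂ => exact h₁.trans h₂

theorem Shuffle.irred {e f : List (Σ i, G i)} (h : Shuffle Γ e f) (he : Irred Γ e) :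
    Irred Γ f := by
  induction h with
  | nil => exact he
  | cons y h ih => exact ⟨he.1, (h.head_eq _).symm.trans he.2.1, ih he.2.2⟩
  | swap e h =>
    obtain ⟨h₁, h₂, h₃, h₄, h₅⟩ := he
    rw [head_cons_adj Γ h.symm] at h₂
    exact ⟨h₃, by rwa [head_cons_adj Γ h], h₁, h₂, h₅⟩
  | trans _ _ h₁ h₂ => exact h₂ (h₁ he)

theorem head_append_of_adj {v : V} {x : List (Σ i, G i)} (h : ∀ y ∈ x, Γ.Adj y.1 v)
    (e : List (Σ i, G i)) : head Γ v (x ++ e) = head Γ v e := by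
  induction x with
  | nil => rfl
  | cons y x ih =>
    rw [List.cons_append, head_cons_adj Γ (h y (by simp)), ih fun z hz => h z (by simp [hz])]

theorem head_append_of_not_adj {v : V} {x : List (Σ i, G i)} (h : ¬ ∀ y ∈ x, Γ.Adj y.1 v)
    (e : List (Σ i, G i)) : head Γ v (x ++ e) = head Γ v x := by
  induction x with
  | nil => simp at h
  | cons y x ih =>
    simp only [List.cons_append, head]
    split_ifs with h₁ h₂
    · rfl
    · exact ih fun h' => h (by simpa [h₂] using h')
    · rfl

/-- All syllables before the front `v`-syllable are adjacent to `v`, so it can be moved past them.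
-/
theorem shuffle_cons_head_tail {v : V} {e : List (Σ i, G i)} (h : head Γ v e ≠ 1) :
    Shuffle Γ e (⟨v, head Γ v e⟩ :: tail Γ v e) := by
  induction e with
  | nil => simp at h
  | cons y e ih =>
    by_cases h₁ : y.1 = v
    · obtain ⟨i, a⟩ := y
      simp only at h₁
      subst h₁
      simpa using Shuffle.refl _
    by_cases h₂ : Γ.Adj y.1 v
    · rw [head_cons_adj Γ h₂] at h ⊢
      rw [tail_cons_adj Γ h₂]
      exact ((ih h).cons y).trans (.swap _ h₂)
    · exact absurd (head_cons_not_adj Γ h₁ h₂ e) h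

/-- Only a front syllable equal to `1` could be deleted here, and irreducibility excludes it. -/
theorem tail_eq_self {v : V} {e : List (Σ i, G i)} (he : Irred Γ e) (h : head Γ v e = 1) :
    tail Γ v e = e := by
  induction e with
  | nil => rfl
  | cons y e ih =>
    by_cases h₁ : y.1 = v
    · obtain ⟨i, a⟩ := y
      simp only at h₁
      subst h₁
      exact absurd (by simpa using h) he.1
    by_cases h₂ : Γ.Adj y.1 v
    · rw [head_cons_adj Γ h₂] at h
      rw [tail_cons_adj Γ h₂, ih he.2.2 h]
    · exact tail_cons_not_adj Γ h₁ h₂ e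

theorem head_tail_adj {u v : V} (h : Γ.Adj u v) (e : List (Σ i, G i)) :
    head Γ u (tail Γ v e) = head Γ u e := by
  induction e with
  | nil => rfl
  | cons y e ih =>
    by_cases h₁ : y.1 = v
    · obtain ⟨i, a⟩ := y
      simp only at h₁
      subst h₁
      rw [tail_cons_self, head_cons_adj Γ h.symm]
    by_cases h₂ : Γ.Adj y.1 v
    · rw [tail_cons_adj Γ h₂]
      simp only [head, ih]
    · rw [tail_cons_not_adj Γ h₁ h₂]

theorem tail_tail_adj {u v : V} (h : Γ.Adj u v) (e : List (Σ i, G i)) :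
    tail Γ u (tail Γ v e) = tail Γ v (tail Γ u e) := by
  induction e with
  | nil => rfl
  | cons y e ih =>
    obtain ⟨i, a⟩ := y
    by_cases h₁ : i = v
    · subst h₁
      rw [tail_cons_self, tail_cons_adj Γ h.symm, tail_cons_self]
    by_cases h₂ : i = u
    · subst h₂
      rw [tail_cons_self, tail_cons_adj Γ h, tail_cons_self]
    simp only [tail, h₁, h₂, if_false]
    split_ifs <;> simp [tail, *]

theorem Irred.head_tail {e : List (Σ i, G i)} (he : Irred Γ e) (v : V) :
    head Γ v (tail Γ v e) = 1 := by
  induction e with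
  | nil => rfl
  | cons y e ih =>
    by_cases h₁ : y.1 = v
    · obtain ⟨i, a⟩ := y
      simp only at h₁
      subst h₁
      rw [tail_cons_self]
      exact he.2.1
    by_cases h₂ : Γ.Adj y.1 v
    · rw [tail_cons_adj Γ h₂, head_cons_adj Γ h₂, ih he.2.2]
    · rw [tail_cons_not_adj Γ h₁ h₂, head_cons_not_adj Γ h₁ h₂]

theorem Irred.tail {e : List (Σ i, G i)} (he : Irred Γ e) (v : V) :
    Irred Γ (tail Γ v e) := by
  by_cases h : head Γ v e = 1
  · rwa [tail_eq_self he h]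
  · exact ((shuffle_cons_head_tail h).irred he).2.2

theorem eval_head_tail (v : V) (e : List (Σ i, G i)) :
    of Γ v (head Γ v e) * eval Γ (tail Γ v e) = eval Γ e := by
  induction e with
  | nil => simp [eval_nil]
  | cons y e ih =>
    by_cases h₁ : y.1 = v
    · obtain ⟨i, a⟩ := y
      simp only at h₁
      subst h₁
      rw [tail_cons_self, head_cons_self, eval_cons]
    by_cases h₂ : Γ.Adj y.1 v
    · rw [tail_cons_adj Γ h₂, head_cons_adj Γ h₂, eval_cons, eval_cons, ← mul_assoc,
        commute_of Γ h₂.symm, mul_assoc, ih]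
    · rw [tail_cons_not_adj Γ h₁ h₂, head_cons_not_adj Γ h₁ h₂]
      simp

/-! ### The action of the graph product on normal forms. -/

variable (Γ)

open Classical in
/-- Multiplication of an expression by `g` in the vertex group `G v` from the left, followed by
merging and deletion of the trivial syllable. -/
def act (v : V) (g : G v) (e : List (Σ i, G i)) : List (Σ i, G i) :=
  if g * head Γ v e = 1 then tail Γ v e else ⟨v, g * head Γ v e⟩ :: tail Γ v e

variable {Γ}

theorem eval_act (v : V) (g : G v) (e : List (Σ i, G i)) :
    eval Γ (act Γ v g e) = of Γ v g * eval Γ e := by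
  rw [← eval_head_tail v e, ← mul_assoc, ← map_mul]
  unfold act
  split_ifs with h
  · rw [h, map_one, one_mul]
  · rw [eval_cons]

theorem Irred.act {e : List (Σ i, G i)} (he : Irred Γ e) (v : V) (g : G v) :
    Irred Γ (act Γ v g e) := by
  unfold GraphProduct.act
  split_ifs with h
  · exact he.tail v
  · exact ⟨h, he.head_tail v, he.tail v⟩

theorem Shuffle.act {e f : List (Σ i, G i)} (h : Shuffle Γ e f) (v : V) (g : G v) :
    Shuffle Γ (act Γ v g e) (act Γ v g f) := by
  unfold GraphProduct.act
  rw [h.head_eq v]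
  split_ifs
  exacts [h.tail v, .cons _ (h.tail v)]

theorem shuffle_act_one {e : List (Σ i, G i)} (he : Irred Γ e) (v : V) :
    Shuffle Γ (act Γ v 1 e) e := by
  unfold act
  rw [one_mul]
  split_ifs with h
  · rw [tail_eq_self he h]
    exact .refl _
  · exact (shuffle_cons_head_tail h).symm

/-- By irreducibility no second `v`-syllable comes to the front when the first is removed, so both
sides alter one and the same syllable. -/
theorem act_mul {e : List (Σ i, G i)} (he : Irred Γ e) (v : V) (g h : G v) :
    act Γ v (g * h) e = act Γ v g (act Γ v h e) := by
  by_cases hh : h * head Γ v e = 1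
  · have : act Γ v h e = tail Γ v e := by simp [act, hh]
    rw [this, act, act, he.head_tail, tail_eq_self (he.tail v) (he.head_tail v), mul_assoc, hh]
  · have : act Γ v h e = ⟨v, h * head Γ v e⟩ :: tail Γ v e := by simp [act, hh]
    rw [this, act, act, head_cons_self, tail_cons_self, mul_assoc]

theorem act_cons_adj {u v : V} (h : Γ.Adj u v) (g : G u) (k : G v) (e : List (Σ i, G i)) :
    Shuffle Γ (act Γ u g (⟨v, k⟩ :: e)) (⟨v, k⟩ :: act Γ u g e) := by
  unfold act
  rw [head_cons_adj Γ h.symm, tail_cons_adj Γ h.symm]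
  split_ifs
  exacts [.refl _, .swap _ h]

theorem head_act_adj {u v : V} (h : Γ.Adj u v) (g : G v) (e : List (Σ i, G i)) :
    head Γ u (act Γ v g e) = head Γ u e := by
  unfold act
  split_ifs
  · exact head_tail_adj h e
  · rw [head_cons_adj Γ h.symm, head_tail_adj h]

theorem tail_act_adj {u v : V} (h : Γ.Adj u v) (g : G v) (e : List (Σ i, G i)) :
    tail Γ u (act Γ v g e) = act Γ v g (tail Γ u e) := by
  unfold act
  rw [head_tail_adj h.symm]
  split_ifs
  · rw [tail_tail_adj h]
  · rw [tail_cons_adj Γ h.symm, tail_tail_adj h]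

theorem shuffle_act_comm {u v : V} (h : Γ.Adj u v) (g : G u) (k : G v) (e : List (Σ i, G i)) :
    Shuffle Γ (act Γ u g (act Γ v k e)) (act Γ v k (act Γ u g e)) := by
  by_cases hg : g * head Γ u e = 1
  · have h₁ : act Γ u g e = tail Γ u e := by simp [act, hg]
    have h₂ : act Γ u g (act Γ v k e) = tail Γ u (act Γ v k e) := by
      simp [act.eq_1 Γ u, head_act_adj h, hg]
    rw [h₁, h₂, tail_act_adj h]
    exact .refl _
  · have h₁ : act Γ u g e = ⟨u, g * head Γ u e⟩ :: tail Γ u e := by simp [act, hg]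
    have h₂ : act Γ u g (act Γ v k e) = ⟨u, g * head Γ u e⟩ :: tail Γ u (act Γ v k e) := by
      simp [act.eq_1 Γ u, head_act_adj h, hg]
    rw [h₁, h₂, tail_act_adj h]
    exact (act_cons_adj h.symm _ _ _).symm

variable (Γ G)

/-- Irreducible expressions up to shuffling. -/
def shuffleSetoid : Setoid {e : List (Σ i, G i) // Irred Γ e} where
  r e f := Shuffle Γ e.1 f.1
  iseqv := ⟨fun e => .refl e.1, fun h => h.symm, fun h₁ h₂ => h₁.trans h₂⟩

/-- The set of irreducible expressions up to shuffling. -/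
abbrev NormalForm : Type (max v w) := Quotient (shuffleSetoid Γ G)

/-- The action of a vertex group on irreducible expressions up to shuffling. -/
def vertexAct (v : V) : G v →* Function.End (NormalForm Γ G) where
  toFun g := Quotient.map (fun e => ⟨act Γ v g e.1, e.2.act v g⟩) fun _ _ h => h.act v g
  map_one' := by
    funext q
    induction q using Quotient.inductionOn with
    | h e => exact Quotient.sound (shuffle_act_one e.2 v)
  map_mul' g h := by
    funext q
    induction q using Quotient.inductionOn with
    | h e =>
      exact congrArg (Quotient.mk (shuffleSetoid Γ G)) (Subtype.ext (act_mul e.2 v g h))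

theorem vertexAct_comm {u v : V} (h : Γ.Adj u v) (a : G u) (b : G v) :
    vertexAct Γ G u a * vertexAct Γ G v b = vertexAct Γ G v b * vertexAct Γ G u a := by
  funext q
  induction q using Quotient.inductionOn with
  | h e => exact Quotient.sound (shuffle_act_comm h a b e.1)

/-- The action of the graph product on irreducible expressions up to shuffling. -/
def actHom : GraphProduct Γ G →* Function.End (NormalForm Γ G) :=
  QuotientGroup.lift _ (Monoid.CoprodI.lift (vertexAct Γ G)) <| by
    intro x hx
    refine Subgroup.normalClosure_le_normal
      (N := (Monoid.CoprodI.lift (vertexAct Γ G)).ker) ?_ hx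
    rintro _ ⟨i, j, a, b, h, rfl⟩
    rw [SetLike.mem_coe, MonoidHom.mem_ker]
    simp only [← map_inv, map_mul, Monoid.CoprodI.lift_of]
    rw [vertexAct_comm Γ G h, mul_assoc (vertexAct Γ G j b), ← map_mul, mul_inv_cancel, map_one,
      mul_one, ← map_mul, mul_inv_cancel, map_one]

variable {Γ G}

theorem actHom_of (v : V) (g : G v) : actHom Γ G (of Γ v g) = vertexAct Γ G v g := by
  change Monoid.CoprodI.lift (vertexAct Γ G) (Monoid.CoprodI.of g) = _
  rw [Monoid.CoprodI.lift_of]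

/-- Van der Waerden's argument: acting on the empty expression rebuilds `e`, since irreducibility
makes each syllable be prepended without merging. Hence the element determines `e` up to shuffling.
-/
theorem actHom_eval {e : List (Σ i, G i)} (he : Irred Γ e) :
    actHom Γ G (eval Γ e) (Quotient.mk _ ⟨[], trivial⟩) = Quotient.mk _ ⟨e, he⟩ := by
  induction e with
  | nil => rw [eval_nil, map_one]; rfl
  | cons y e ih =>
    rw [eval_cons, map_mul, actHom_of]
    change vertexAct Γ G y.1 y.2 (actHom Γ G (eval Γ e) (Quotient.mk _ ⟨[], trivial⟩)) = _
    rw [ih he.2.2]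
    refine congrArg (Quotient.mk (shuffleSetoid Γ G)) (Subtype.ext ?_)
    simp [act, he.2.1, he.1, tail_eq_self he.2.2 he.2.1]

/-- Irreducible expressions of the same element are shuffles of each other. -/
theorem shuffle_of_eval_eq {e f : List (Σ i, G i)} (he : Irred Γ e) (hf : Irred Γ f)
    (h : eval Γ e = eval Γ f) : Shuffle Γ e f := by
  have := actHom_eval he
  rw [h, actHom_eval hf] at this
  exact (Quotient.exact this).symm

theorem eval_surjective : Function.Surjective (eval Γ : List (Σ i, G i) → GraphProduct Γ G) := by
  intro g
  obtain ⟨x, rfl⟩ := QuotientGroup.mk_surjective g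
  induction x using Monoid.CoprodI.induction_on with
  | one => exact ⟨[], rfl⟩
  | of i m => exact ⟨[⟨i, m⟩], by rw [eval_cons, eval_nil, mul_one]; rfl⟩
  | mul x y hx hy =>
    obtain ⟨e, he⟩ := hx
    obtain ⟨f, hf⟩ := hy
    exact ⟨e ++ f, by rw [eval_append, he, hf]; rfl⟩

variable (Γ) in
/-- The irreducible expression obtained by reducing an expression from the right. -/
def normalize (e : List (Σ i, G i)) : List (Σ i, G i) :=
  e.foldr (fun y f => act Γ y.1 y.2 f) []

theorem irred_normalize (e : List (Σ i, G i)) : Irred Γ (normalize Γ e) := by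
  induction e with
  | nil => trivial
  | cons y e ih => exact ih.act y.1 y.2

theorem eval_normalize (e : List (Σ i, G i)) : eval Γ (normalize Γ e) = eval Γ e := by
  induction e with
  | nil => rfl
  | cons y e ih =>
    rw [eval_cons, ← ih]
    exact eval_act _ _ _

theorem exists_irred (g : GraphProduct Γ G) : ∃ e, Irred Γ e ∧ eval Γ e = g := by
  obtain ⟨e, rfl⟩ := eval_surjective g
  exact ⟨_, irred_normalize e, eval_normalize e⟩

/-- Some syllable is either trivial, and can be dropped, or merges with the front syllable of what
follows it. -/
theorem exists_shorter {e : List (Σ i, G i)} (he : ¬ Irred Γ e) :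
    ∃ f, eval Γ f = eval Γ e ∧ f.length < e.length := by
  induction e with
  | nil => exact absurd trivial he
  | cons y e ih =>
    by_cases h₁ : Irred Γ e
    · by_cases h₂ : y.2 = 1
      · exact ⟨e, by rw [eval_cons, h₂, map_one, one_mul], by simp⟩
      · have h₃ : head Γ y.1 e ≠ 1 := fun h => he ⟨h₂, h, h₁⟩
        refine ⟨act Γ y.1 y.2 e, by rw [eval_act, eval_cons], ?_⟩
        have := (shuffle_cons_head_tail h₃).perm.length_eq
        unfold act
        split_ifs <;> simp_all
    · obtain ⟨f, hf, hl⟩ := ih h₁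
      exact ⟨y :: f, by rw [eval_cons, eval_cons, hf], by simpa using hl⟩

theorem IsReduced.irred {e : List (Σ i, G i)} (he : IsReduced Γ e) : Irred Γ e := by
  by_contra h
  obtain ⟨f, hf, hl⟩ := exists_shorter h
  exact absurd (he f hf) (by omega)

end Words

/-! ### Cancellation in products and uniqueness of splittings. -/

section Decomposition

variable {V : Type v} {Γ : SimpleGraph V} {G : V → Type w} [∀ i, Group (G i)]

/-- The expression `s_{v₁} ⋯ s_{v_k}` for a list `v₁, …, v_k` of vertices. -/
def syllables (Λ : List V) (s : ∀ i, G i) : List (Σ i, G i) :=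
  Λ.map fun v => ⟨v, s v⟩

/-- The expression of the inverse. -/
def inverse (e : List (Σ i, G i)) : List (Σ i, G i) :=
  (e.map fun y => ⟨y.1, y.2⁻¹⟩).reverse

theorem inverse_cons (y : Σ i, G i) (e : List (Σ i, G i)) :
    inverse (y :: e) = inverse e ++ [⟨y.1, y.2⁻¹⟩] := by simp [inverse]

theorem eval_inverse (e : List (Σ i, G i)) : eval Γ (inverse e) = (eval Γ e)⁻¹ := by
  induction e with
  | nil => simp [inverse, eval]
  | cons y e ih =>
    rw [inverse_cons, eval_append, ih, eval_cons, eval_cons, eval_nil, mul_inv_rev, map_inv,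
      mul_one]

theorem syllables_congr {Λ : List V} {s t : ∀ i, G i} (h : ∀ v ∈ Λ, s v = t v) :
    syllables Λ s = syllables Λ t :=
  List.map_congr_left fun v hv => by rw [h v hv]

theorem eval_syllables_mul {Λ : List V} (hΛ : Λ.Pairwise Γ.Adj) (s t : ∀ i, G i) :
    eval Γ (syllables Λ (s * t)) = eval Γ (syllables Λ s) * eval Γ (syllables Λ t) := by
  induction Λ with
  | nil => simp [syllables, eval]
  | cons v Λ ih =>
    rw [List.pairwise_cons] at hΛ
    have h : of Γ v (t v) * eval Γ (syllables Λ s) = eval Γ (syllables Λ s) * of Γ v (t v) := by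
      have := (Shuffle.cons_append (Γ := Γ) (y := ⟨v, t v⟩) (x := syllables Λ s)
        (by
          intro z hz
          obtain ⟨u, hu, rfl⟩ := List.mem_map.1 hz
          exact (hΛ.1 u hu).symm) []).eval_eq
      simpa [eval_cons, eval_append, eval_nil] using this
    have ih := ih hΛ.2
    simp only [syllables, List.map_cons, eval_cons, Pi.mul_apply, map_mul] at ih h ⊢
    rw [ih, mul_assoc, mul_assoc, ← mul_assoc (of Γ v (t v)), h]
    simp only [mul_assoc]

theorem Irred.ne_one {e : List (Σ i, G i)} (he : Irred Γ e) : ∀ y ∈ e, y.2 ≠ 1 := by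
  induction e with
  | nil => simp
  | cons y e ih =>
    intro z hz
    rcases List.mem_cons.1 hz with rfl | hz
    exacts [he.1, ih he.2.2 z hz]

/-- For nontrivial syllables, irreducibility depends only on the sequence of vertices. -/
theorem Irred.replace {v : V} {b b' : G v} {x y : List (Σ i, G i)}
    (h : Irred Γ (x ++ ⟨v, b⟩ :: y)) (hb' : b' ≠ 1) : Irred Γ (x ++ ⟨v, b'⟩ :: y) := by
  have hb : b ≠ 1 := h.ne_one ⟨v, b⟩ (by simp)
  induction x with
  | nil => exact ⟨hb', h.2⟩
  | cons z x ih =>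
    rw [List.cons_append] at h ⊢
    refine ⟨h.1, ?_, ih h.2.2⟩
    have h₁ := h.2.1
    by_cases hx : ∀ w ∈ x, Γ.Adj w.1 z.1
    · rw [head_append_of_adj hx] at h₁ ⊢
      by_cases hv : v = z.1
      · subst hv
        exact absurd (by simpa using h₁) hb
      · simpa only [head, hv, dite_false] using h₁
    · rwa [head_append_of_not_adj hx] at h₁ ⊢

/-- A syllable adjacent to everything before it never keeps a syllable of `x` from merging with a
later one. -/
theorem Irred.erase {y : Σ i, G i} {x e : List (Σ i, G i)}
    (h : Irred Γ (x ++ y :: e)) (hx : ∀ z ∈ x, Γ.Adj z.1 y.1) : Irred Γ (x ++ e) := by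
  induction x with
  | nil => exact h.2.2
  | cons z x ih =>
    rw [List.cons_append] at h ⊢
    refine ⟨h.1, ?_, ih h.2.2 fun t ht => hx t (by simp [ht])⟩
    have h₁ := h.2.1
    by_cases hx' : ∀ w ∈ x, Γ.Adj w.1 z.1
    · rwa [head_append_of_adj hx', head_cons_adj Γ (hx z (by simp)).symm,
        ← head_append_of_adj hx'] at h₁
    · rwa [head_append_of_not_adj hx'] at h₁ ⊢

theorem head_syllables_of_mem {v : V} {Λ : List V} (hΛ : Λ.Pairwise Γ.Adj) (hv : v ∈ Λ)
    (s : ∀ i, G i) (e : List (Σ i, G i)) : head Γ v (syllables Λ s ++ e) = s v := by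
  induction Λ with
  | nil => simp at hv
  | cons u Λ ih =>
    rw [List.pairwise_cons] at hΛ
    simp only [syllables, List.map_cons, List.cons_append]
    rcases eq_or_ne u v with rfl | huv
    · simp
    · have hv' : v ∈ Λ := by simpa [huv.symm] using hv
      rw [head_cons_adj Γ (y := ⟨u, s u⟩) (hΛ.1 v hv')]
      exact ih hΛ.2 hv'

theorem head_syllables_of_notMem {v : V} {Λ : List V} (hv : v ∉ Λ)
    (h : ¬ ∀ u ∈ Λ, Γ.Adj u v) (s : ∀ i, G i) (e : List (Σ i, G i)) :
    head Γ v (syllables Λ s ++ e) = 1 := by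
  induction Λ with
  | nil => simp at h
  | cons u Λ ih =>
    simp only [List.mem_cons, not_or] at hv
    simp only [syllables, List.map_cons, List.cons_append]
    by_cases hu : Γ.Adj u v
    · rw [head_cons_adj Γ (y := ⟨u, s u⟩) hu]
      exact ih hv.2 fun h' => h (by simpa [hu] using h')
    · exact head_cons_not_adj Γ (y := ⟨u, s u⟩) (Ne.symm hv.1) hu _

theorem adj_syllables {v : V} {Λ : List V} (h : ∀ u ∈ Λ, Γ.Adj u v) (s : ∀ i, G i) :
    ∀ y ∈ syllables Λ s, Γ.Adj y.1 v := by
  intro y hy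
  obtain ⟨u, hu, rfl⟩ := List.mem_map.1 hy
  exact h u hu

/-- The cancellation in the product of two irreducible expressions `e` and `f`: after shuffling,
`e = p s q` and `f = q⁻¹ t r` with `s` and `t` in the product of the vertex groups of a clique,
such that `p (s t) r` is irreducible. -/
theorem exists_cancellation {e f : List (Σ i, G i)} (he : Irred Γ e) (hf : Irred Γ f) :
    ∃ (p q r : List (Σ i, G i)) (Λ : List V) (s t : ∀ i, G i), Λ.Pairwise Γ.Adj ∧
      (∀ v, v ∉ Λ → s v = 1 ∧ t v = 1) ∧
      Shuffle Γ e (p ++ (syllables Λ s ++ q)) ∧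
      Shuffle Γ f (inverse q ++ (syllables Λ t ++ r)) ∧
      Irred Γ (p ++ (syllables Λ (s * t) ++ r)) := by
  classical
  induction e with
  | nil => exact ⟨[], [], f, [], 1, 1, by simp, by simp, .nil, .refl _, hf⟩
  | cons y e ih =>
    obtain ⟨p, q, r, Λ, s, t, hΛ, hst, h₁, h₂, h₃⟩ := ih he.2.2
    have hye : Irred Γ (y :: (p ++ (syllables Λ s ++ q))) := (h₁.cons y).irred he
    -- If `y` merges with nothing in `p (s t) r`, it joins `p`.
    by_cases hy : head Γ y.1 (p ++ (syllables Λ (s * t) ++ r)) = 1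
    · exact ⟨y :: p, q, r, Λ, s, t, hΛ, hst, .cons y h₁, h₂, hye.1, hy, h₃⟩
    obtain ⟨v, a⟩ := y
    simp only at hy
    have hya := hye.2.1
    simp only at hya
    -- Otherwise `p` alone decides the front `v`-syllable of both `p s q` and `p (s t) r`, but only
    -- the first of these is trivial.
    have hp : ∀ z ∈ p, Γ.Adj z.1 v := by
      by_contra hp
      rw [head_append_of_not_adj hp] at hy hya
      exact hy hya
    rw [head_append_of_adj hp] at hy hya
    -- If `v ∈ Λ`, then `y` would already merge with `s v` in the irreducible `y p s q`. If `v ∉ Λ`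
    -- is not adjacent to all of `Λ`, the syllables of `s t` block `y`.
    have hΛv : ∀ u ∈ Λ, Γ.Adj u v := by
      by_contra h
      by_cases hv : v ∈ Λ
      · rw [head_syllables_of_mem hΛ hv] at hya
        exact hye.2.2.ne_one ⟨v, s v⟩
          (List.mem_append_right _ (List.mem_append_left _ (List.mem_map_of_mem hv))) hya
      · exact hy (head_syllables_of_notMem hv h _ _)
    have hv : v ∉ Λ := fun h => Γ.irrefl (hΛv v h)
    rw [head_append_of_adj (adj_syllables hΛv _)] at hy
    set b := head Γ v r with hb
    have hr := shuffle_cons_head_tail hy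
    rw [← hb] at hr
    set r' := tail Γ v r
    have h₄ : Irred Γ (p ++ ⟨v, b⟩ :: (syllables Λ (s * t) ++ r')) :=
      (((hr.append_left _).trans
        (Shuffle.cons_append (adj_syllables hΛv _) _).symm).append_left p).irred h₃
    -- Thus `y` meets the front syllable `b` of `r`. Either they cancel and `y` joins `q`, or they
    -- merge and `v` joins the clique.
    by_cases hab : a * b = 1
    · refine ⟨p, ⟨v, a⟩ :: q, r', Λ, s, t, hΛ, hst, ?_, ?_, ?_⟩
      · exact (Shuffle.cons _ h₁).trans ((Shuffle.cons_append hp _).trans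
          ((Shuffle.cons_append (adj_syllables hΛv s) q).append_left p))
      · refine h₂.trans ?_
        rw [inverse_cons, List.append_assoc, ← eq_inv_of_mul_eq_one_right hab]
        exact ((hr.append_left _).trans
          (Shuffle.cons_append (adj_syllables hΛv _) _).symm).append_left _
      · exact h₄.erase hp
    · have hs : syllables Λ (Function.update s v a) = syllables Λ s :=
        syllables_congr fun u hu => Function.update_of_ne (ne_of_mem_of_not_mem hu hv) _ _
      have ht : syllables Λ (Function.update t v b) = syllables Λ t :=
        syllables_congr fun u hu => Function.update_of_ne (ne_of_mem_of_not_mem hu hv) _ _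
      have hst' : syllables Λ (Function.update s v a * Function.update t v b) =
          syllables Λ (s * t) :=
        syllables_congr fun u hu => by
          have : u ≠ v := ne_of_mem_of_not_mem hu hv
          simp [this]
      refine ⟨p, q, r', v :: Λ, Function.update s v a, Function.update t v b,
        List.pairwise_cons.2 ⟨fun u hu => (hΛv u hu).symm, hΛ⟩, ?_, ?_, ?_, ?_⟩
      · intro u hu
        simp only [List.mem_cons, not_or] at hu
        simpa [hu.1] using hst u hu.2
      · have : syllables (v :: Λ) (Function.update s v a) = ⟨v, a⟩ :: syllables Λ s := by
          rw [← hs]; simp [syllables]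
        rw [this]
        exact (Shuffle.cons _ h₁).trans (Shuffle.cons_append hp _)
      · have : syllables (v :: Λ) (Function.update t v b) = ⟨v, b⟩ :: syllables Λ t := by
          rw [← ht]; simp [syllables]
        rw [this]
        exact h₂.trans (((hr.append_left _).trans
          (Shuffle.cons_append (adj_syllables hΛv _) _).symm).append_left _)
      · have : syllables (v :: Λ) (Function.update s v a * Function.update t v b) =
            ⟨v, a * b⟩ :: syllables Λ (s * t) := by
          rw [← hst']; simp [syllables]
        rw [this]
        exact h₄.replace hab

open Classical in
/-- The part of an expression made of the syllables in two given vertex groups. -/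
def restrict (u v : V) (e : List (Σ i, G i)) : List (Σ i, G i) :=
  e.filter fun y => y.1 = u ∨ y.1 = v

theorem restrict_append (u v : V) (e f : List (Σ i, G i)) :
    restrict u v (e ++ f) = restrict u v e ++ restrict u v f := by
  simp [restrict]

theorem Shuffle.restrict_eq {e f : List (Σ i, G i)} (h : Shuffle Γ e f) {u v : V}
    (huv : ¬ Γ.Adj u v) : restrict u v e = restrict u v f := by
  induction h with
  | nil => rfl
  | cons y _ ih => simp only [restrict, List.filter_cons] at ih ⊢; rw [ih]
  | @swap y z e h =>
    have : ¬ ((y.1 = u ∨ y.1 = v) ∧ (z.1 = u ∨ z.1 = v)) := by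
      rintro ⟨h₁ | h₁, h₂ | h₂⟩ <;> rw [h₁, h₂] at h
      exacts [Γ.irrefl h, huv h, huv h.symm, Γ.irrefl h]
    simp only [restrict, List.filter_cons, decide_eq_true_eq]
    split_ifs with h₁ h₂
    exacts [absurd ⟨by simpa using h₁, by simpa using h₂⟩ this, rfl, rfl, rfl]
  | trans _ _ h₁ h₂ => exact h₁.trans h₂

theorem mem_restrict {u v : V} {e : List (Σ i, G i)} {y : Σ i, G i} :
    y ∈ restrict u v e ↔ y ∈ e ∧ (y.1 = u ∨ y.1 = v) := by
  simp [restrict]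

/-- The projection criterion for partially commutative monoids. The case `u = v` locates the first
syllable of `e` inside `f`; the pairs `u ≠ v` show that it can be moved to the front of `f`. -/
theorem shuffle_of_restrict_eq {e f : List (Σ i, G i)}
    (h : ∀ u v, ¬ Γ.Adj u v → restrict u v e = restrict u v f) : Shuffle Γ e f := by
  classical
  induction e generalizing f with
  | nil =>
    have : f = [] := List.eq_nil_iff_forall_not_mem.2 fun y hy => by
      have := mem_restrict (u := y.1) (v := y.1).2 ⟨hy, Or.inl rfl⟩
      rw [← h y.1 y.1 Γ.irrefl] at this
      simp [restrict] at this
    rw [this]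
    exact .nil
  | cons y e ih =>
    have hy : restrict y.1 y.1 f = y :: restrict y.1 y.1 e := by
      rw [← h y.1 y.1 Γ.irrefl]
      simp [restrict]
    obtain ⟨r, s, rfl, hr, -, -⟩ := List.filter_eq_cons_iff.1 hy
    have hr' : ∀ z ∈ r, z.1 ≠ y.1 := fun z hz => by simpa using hr z hz
    -- A nonadjacent `z` before `y` would make the restriction of `f` to the two vertices start with
    -- a syllable of `r`, while that of `e` starts with `y`.
    have hadj : ∀ z ∈ r, Γ.Adj z.1 y.1 := by
      intro z hz
      by_contra hzy
      have h₁ := h z.1 y.1 hzy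
      have h₂ : restrict z.1 y.1 (y :: e) = y :: restrict z.1 y.1 e := by simp [restrict]
      rw [h₂, restrict_append] at h₁
      have h₃ : z ∈ restrict z.1 y.1 r := mem_restrict.2 ⟨hz, Or.inl rfl⟩
      cases h₄ : restrict z.1 y.1 r with
      | nil => simp [h₄] at h₃
      | cons t l =>
        rw [h₄, List.cons_append, List.cons.injEq] at h₁
        have : t ∈ restrict z.1 y.1 r := by simp [h₄]
        exact hr' t (mem_restrict.1 this).1 (by rw [← h₁.1])
    have hsh : Shuffle Γ (y :: (r ++ s)) (r ++ y :: s) := Shuffle.cons_append hadj s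
    refine (Shuffle.cons y (ih fun u v huv => ?_)).trans hsh
    have h₁ := (h u v huv).trans (hsh.restrict_eq huv).symm
    simp only [restrict, List.filter_cons] at h₁ ⊢
    split_ifs at h₁
    exacts [(List.cons.inj h₁).2, h₁]

open Classical in
/-- The number of syllables of an expression in a given vertex group. -/
def syllableCount (e : List (Σ i, G i)) (v : V) : ℕ := (e.map Sigma.fst).count v

theorem syllableCount_le (e : List (Σ i, G i)) (v : V) : syllableCount e v ≤ e.length := by
  classical
  exact List.count_le_length.trans (by simp)

theorem length_restrict_eq {e f : List (Σ i, G i)}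
    (h : (e.map Sigma.fst).Perm (f.map Sigma.fst)) (u v : V) :
    (restrict u v e).length = (restrict u v f).length := by
  classical
  have key : ∀ e : List (Σ i, G i), (restrict u v e).length =
      ((e.map Sigma.fst).filter fun i => i = u ∨ i = v).length := by
    intro e
    rw [List.filter_map, List.length_map]
    simp [restrict, Function.comp_def]
  rw [key, key]
  exact (h.filter _).length_eq

variable (Γ) in
/-- `a s b` is an irreducible product in which `a` has `m v` syllables in each `G v`, and `s` is in
the product of the vertex groups of `Λ`. -/
def IsSplitting (Λ : List V) (m : V → ℕ) (a : GraphProduct Γ G) (s : ∀ i, G i)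
    (b : GraphProduct Γ G) : Prop :=
  ∃ p r, eval Γ p = a ∧ eval Γ r = b ∧ syllableCount p = m ∧ (∀ v, v ∉ Λ → s v = 1) ∧
    Irred Γ (p ++ (syllables Λ s ++ r))

/-- Both products are shuffles of each other, so they have equal restrictions to nonadjacent pairs.
The prescribed counts `m` and `Λ` cut each restriction at the same places, so the three factors have
equal restrictions separately. -/
theorem IsSplitting.unique {Λ : List V} {m : V → ℕ} {a a' b b' : GraphProduct Γ G}
    {s s' : ∀ i, G i} (h : IsSplitting Γ Λ m a s b) (h' : IsSplitting Γ Λ m a' s' b')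
    (heq : a * (eval Γ (syllables Λ s) * b) = a' * (eval Γ (syllables Λ s') * b')) :
    a = a' ∧ s = s' ∧ b = b' := by
  classical
  obtain ⟨p, r, rfl, rfl, hm, hs, hi⟩ := h
  obtain ⟨p', r', rfl, rfl, hm', hs', hi'⟩ := h'
  have hsh := shuffle_of_eval_eq hi hi' (by simpa only [eval_append] using heq)
  have hp : (p.map Sigma.fst).Perm (p'.map Sigma.fst) :=
    List.perm_iff_count.2 fun v => by
      have := congrFun (hm.trans hm'.symm) v
      unfold syllableCount at this
      convert this
  have hσ : ((syllables Λ s).map Sigma.fst).Perm ((syllables Λ s').map Sigma.fst) := by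
    simp [syllables, Function.comp_def]
  have hfst : ∀ u v, ¬ Γ.Adj u v → restrict u v p = restrict u v p' ∧
      restrict u v (syllables Λ s) = restrict u v (syllables Λ s') ∧
      restrict u v r = restrict u v r' := by
    intro u v huv
    have h := hsh.restrict_eq huv
    simp only [restrict_append] at h
    have h₁ := List.append_inj h (length_restrict_eq hp u v)
    exact ⟨h₁.1, List.append_inj h₁.2 (length_restrict_eq hσ u v)⟩
  refine ⟨(shuffle_of_restrict_eq fun u v huv => (hfst u v huv).1).eval_eq, ?_,
    (shuffle_of_restrict_eq fun u v huv => (hfst u v huv).2.2).eval_eq⟩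
  have hσ' := (shuffle_of_restrict_eq fun u v huv => (hfst u v huv).2.1).perm
  funext v
  by_cases hv : v ∈ Λ
  · have : (⟨v, s v⟩ : Σ i, G i) ∈ syllables Λ s' :=
      hσ'.subset (List.mem_map_of_mem hv)
    obtain ⟨u, -, hu⟩ := List.mem_map.1 this
    obtain ⟨rfl, hu⟩ := Sigma.mk.inj_iff.1 hu
    exact (eq_of_heq hu).symm
  · rw [hs v hv, hs' v hv]

/-- Both counts are bounded through `e` alone, because `c⁻¹` has as many syllables as `c`, which is
a part of `g`. The length of `h` plays no role. -/
theorem exists_splitting (g h : GraphProduct Γ G) {e : List (Σ i, G i)} (he : Irred Γ e)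
    (heg : eval Γ e = g) :
    ∃ (m n : V → ℕ) (Λ : List V) (a c b : GraphProduct Γ G) (s t : ∀ i, G i),
      (∀ v, m v ≤ e.length) ∧ (∀ v, n v ≤ e.length) ∧ Λ.Pairwise Γ.Adj ∧
      a * (eval Γ (syllables Λ s) * c) = g ∧ c⁻¹ * (eval Γ (syllables Λ t) * b) = h ∧
      IsSplitting Γ Λ m a s c ∧ IsSplitting Γ Λ n c⁻¹ t b ∧ IsSplitting Γ Λ m a (s * t) b := by
  obtain ⟨f, hf, rfl⟩ := exists_irred h
  subst heg
  obtain ⟨p, q, r, Λ, s, t, hΛ, hst, h₁, h₂, h₃⟩ := exists_cancellation he hf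
  have hl := h₁.perm.length_eq
  simp only [List.length_append] at hl
  refine ⟨syllableCount p, syllableCount (inverse q), Λ, eval Γ p, eval Γ q, eval Γ r, s, t,
    fun v => (syllableCount_le p v).trans (by omega), fun v => (syllableCount_le _ v).trans ?_, hΛ,
    by rw [h₁.eval_eq, eval_append, eval_append],
    by rw [h₂.eval_eq, eval_append, eval_append, eval_inverse],
    ⟨p, q, rfl, rfl, rfl, fun v hv => (hst v hv).1, h₁.irred he⟩,
    ⟨inverse q, r, eval_inverse q, rfl, rfl, fun v hv => (hst v hv).2, h₂.irred hf⟩,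
    ⟨p, r, rfl, rfl, rfl, fun v hv => by simp [hst v hv], h₃⟩⟩
  simp only [inverse, List.length_reverse, List.length_map]
  omega

end Decomposition

/-! ### The length function on the graph product. -/

section Length

variable {V : Type v} {Γ : SimpleGraph V} {G : V → Type w} [∀ i, Group (G i)]
  (l : ∀ i, GroupSeminorm (G i))

/-- The sum of the lengths of the syllables of an expression. -/
def weight (e : List (Σ i, G i)) : ℝ := (e.map fun y => l y.1 y.2).sum

theorem Shuffle.weight_eq {e f : List (Σ i, G i)} (h : Shuffle Γ e f) :
    weight l e = weight l f :=
  (h.perm.map _).sum_eq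

theorem weight_append (e f : List (Σ i, G i)) : weight l (e ++ f) = weight l e + weight l f := by
  simp [weight]

theorem weight_nonneg (e : List (Σ i, G i)) : 0 ≤ weight l e :=
  List.sum_nonneg fun x hx => by
    obtain ⟨y, -, rfl⟩ := List.mem_map.1 hx
    exact apply_nonneg _ _

theorem weight_inverse (e : List (Σ i, G i)) : weight l (inverse e) = weight l e := by
  simp [weight, inverse, Function.comp_def]

theorem weight_act_le (v : V) (g : G v) (e : List (Σ i, G i)) :
    weight l (act Γ v g e) ≤ l v g + weight l e := by
  have h : weight l (tail Γ v e) + l v (head Γ v e) ≤ weight l e := by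
    induction e with
    | nil => simp [weight]
    | cons y e ih =>
      by_cases h₁ : y.1 = v
      · obtain ⟨i, a⟩ := y
        simp only at h₁
        subst h₁
        simp [weight, add_comm]
      by_cases h₂ : Γ.Adj y.1 v
      · rw [tail_cons_adj Γ h₂, head_cons_adj Γ h₂]
        simp only [weight, List.map_cons, List.sum_cons] at ih ⊢
        linarith
      · rw [tail_cons_not_adj Γ h₁ h₂, head_cons_not_adj Γ h₁ h₂]
        simp
  unfold act
  split_ifs with hg
  · have h₁ := apply_nonneg (l v) g
    have h₂ := apply_nonneg (l v) (head Γ v e)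
    linarith
  · have := map_mul_le_add (l v) g (head Γ v e)
    simp only [weight, List.map_cons, List.sum_cons] at h ⊢
    linarith

theorem weight_normalize_le (e : List (Σ i, G i)) : weight l (normalize Γ e) ≤ weight l e := by
  induction e with
  | nil => rfl
  | cons y e ih =>
    refine (weight_act_le l y.1 y.2 (normalize Γ e)).trans ?_
    simp only [weight, List.map_cons, List.sum_cons] at ih ⊢
    linarith

/-- Normalizing `f` ends in a shuffle of `e` and does not increase the weight, as each `l i` is
subadditive. This minimality yields the triangle inequality and the symmetry of `length`. -/
theorem Irred.weight_le {e f : List (Σ i, G i)} (he : Irred Γ e) (h : eval Γ f = eval Γ e) :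
    weight l e ≤ weight l f := by
  rw [(shuffle_of_eval_eq he (irred_normalize f) (by rw [eval_normalize, h])).weight_eq l]
  exact weight_normalize_le l f

variable (Γ) in
/-- The length function on the graph product that sums the lengths of the syllables of a reduced
expression. -/
def length : GroupSeminorm (GraphProduct Γ G) where
  toFun g := weight l (exists_irred g).choose
  map_one' := by
    have h := (exists_irred (1 : GraphProduct Γ G)).choose_spec
    refine le_antisymm (h.1.weight_le l (f := []) ?_) (weight_nonneg l _)
    rw [h.2, eval_nil]
  mul_le' g h := by
    have hg := (exists_irred g).choose_spec
    have hh := (exists_irred h).choose_spec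
    have hgh := (exists_irred (g * h)).choose_spec
    rw [← weight_append]
    exact hgh.1.weight_le l (by rw [hgh.2, eval_append, hg.2, hh.2])
  inv' g := by
    have key : ∀ g : GraphProduct Γ G,
        weight l (exists_irred g⁻¹).choose ≤ weight l (exists_irred g).choose := by
      intro g
      have h := (exists_irred g).choose_spec
      have h' := (exists_irred g⁻¹).choose_spec
      rw [← weight_inverse l (exists_irred g).choose]
      exact h'.1.weight_le l (by rw [h'.2, eval_inverse, h.2])
    refine le_antisymm (key g) ?_
    simpa using key g⁻¹

theorem length_eval {e : List (Σ i, G i)} (he : Irred Γ e) :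
    length Γ l (eval Γ e) = weight l e := by
  have h := (exists_irred (eval Γ e)).choose_spec
  exact (shuffle_of_eval_eq h.1 he h.2).weight_eq l

theorem le_weight {e : List (Σ i, G i)} {y : Σ i, G i} (hy : y ∈ e) : l y.1 y.2 ≤ weight l e :=
  List.single_le_sum (fun x hx => by
    obtain ⟨z, -, rfl⟩ := List.mem_map.1 hx
    exact apply_nonneg _ _) _ (List.mem_map_of_mem hy)

theorem IsSplitting.le_length {Λ : List V} {m : V → ℕ} {a b : GraphProduct Γ G}
    {s : ∀ i, G i} (h : IsSplitting Γ Λ m a s b) (v : V) :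
    l v (s v) ≤ length Γ l (a * (eval Γ (syllables Λ s) * b)) := by
  obtain ⟨p, r, rfl, rfl, -, hs, hi⟩ := h
  by_cases hv : v ∈ Λ
  · rw [← eval_append, ← eval_append, length_eval l hi]
    exact le_weight l (y := ⟨v, s v⟩)
      (List.mem_append_right _ (List.mem_append_left _ (List.mem_map_of_mem hv)))
  · rw [hs v hv, map_one_eq_zero]
    exact apply_nonneg _ _

theorem Irred.mul_length_le {e : List (Σ i, G i)} (he : Irred Γ e) {c : ℝ}
    (hc : ∀ i, ∀ g : G i, g ≠ 1 → c ≤ l i g) : c * e.length ≤ weight l e := by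
  induction e with
  | nil => simp [weight]
  | cons y e ih =>
    have h₁ := ih he.2.2
    have h₂ := hc y.1 y.2 he.1
    simp only [weight, List.map_cons, List.sum_cons, List.length_cons] at h₁ ⊢
    push_cast
    linarith

end Length

end GraphProduct

/-! ### The `ℓ²`-norm in `[0, ∞]`, where sums need no summability. -/

section L2Norm

variable {α β γ : Type*}

/-- The `ℓ²`-norm of a function with values in `[0, ∞]`. -/
def l2norm (f : α → ℝ≥0∞) : ℝ≥0∞ := (∑' a, f a ^ 2) ^ (1 / 2 : ℝ)

theorem l2norm_sq (f : α → ℝ≥0∞) : l2norm f ^ 2 = ∑' a, f a ^ 2 := by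
  rw [l2norm, ← ENNReal.rpow_natCast, ← ENNReal.rpow_mul]
  norm_num

theorem le_of_sq_le {a b : ℝ≥0∞} (h : a ^ 2 ≤ b ^ 2) : a ≤ b :=
  (ENNReal.pow_le_pow_left_iff two_ne_zero).1 h

theorem l2norm_eq_of_sq {f : α → ℝ≥0∞} {a : ℝ≥0∞} (h : ∑' i, f i ^ 2 = a ^ 2) : l2norm f = a :=
  le_antisymm (le_of_sq_le (by rw [l2norm_sq, h])) (le_of_sq_le (by rw [l2norm_sq, h]))

theorem tsum_mul_le_l2norm_mul (f g : α → ℝ≥0∞) : ∑' a, f a * g a ≤ l2norm f * l2norm g := by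
  let _ : MeasurableSpace α := ⊤
  have h := ENNReal.lintegral_mul_le_Lp_mul_Lq (μ := MeasureTheory.Measure.count)
    Real.HolderConjugate.two_two (f := f) (g := g) measurable_from_top.aemeasurable
    measurable_from_top.aemeasurable
  simp only [MeasureTheory.lintegral_count, Pi.mul_apply, ENNReal.rpow_ofNat] at h
  exact h

theorem l2norm_prod (f : α → β → ℝ≥0∞) :
    l2norm (fun a => l2norm (f a)) = l2norm fun p : α × β => f p.1 p.2 := by
  refine l2norm_eq_of_sq ?_
  simp only [l2norm_sq]
  rw [ENNReal.tsum_prod']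

theorem l2norm_mul (f : α → ℝ≥0∞) (g : β → ℝ≥0∞) :
    l2norm (fun p : α × β => f p.1 * g p.2) = l2norm f * l2norm g := by
  refine l2norm_eq_of_sq ?_
  rw [ENNReal.tsum_prod', mul_pow, l2norm_sq, l2norm_sq]
  simp only [mul_pow, ENNReal.tsum_mul_left, ENNReal.tsum_mul_right]

theorem l2norm_comp_equiv (e : α ≃ β) (f : β → ℝ≥0∞) : l2norm (fun a => f (e a)) = l2norm f := by
  unfold l2norm
  rw [e.tsum_eq fun b => f b ^ 2]

open Classical in
theorem l2norm_indicator_comp_le {P : α → Prop} {φ : α → β}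
    (h : ∀ a a', P a → P a' → φ a = φ a' → a = a') (f : β → ℝ≥0∞) :
    l2norm (fun a => if P a then f (φ a) else 0) ≤ l2norm f := by
  refine le_of_sq_le ?_
  rw [l2norm_sq, l2norm_sq]
  have hs : Function.support (fun a => (if P a then f (φ a) else 0) ^ 2) ⊆ {a | P a} := by
    intro a ha
    by_contra hP
    simp only [Set.mem_ofPred_eq] at hP
    simp [hP] at ha
  rw [← tsum_subtype_eq_of_support_subset hs]
  have hinj : Function.Injective fun a : {a | P a} => φ a :=
    fun a b hab => Subtype.ext (h _ _ a.2 b.2 hab)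
  refine le_trans (le_of_eq (tsum_congr fun a => ?_))
    (ENNReal.tsum_comp_le_tsum_of_injective hinj fun b => f b ^ 2)
  have : P a := a.2
  simp [this]

theorem eq_zero_of_l2norm_eq_zero {f : α → ℝ≥0∞} (h : l2norm f = 0) (a : α) : f a = 0 := by
  have h₁ := l2norm_sq f
  rw [h] at h₁
  have := ENNReal.tsum_eq_zero.1 (h₁.symm.trans (by norm_num)) a
  exact pow_eq_zero_iff two_ne_zero |>.1 this

theorem apply_ne_top_of_l2norm_ne_top {f : α → ℝ≥0∞} (h : l2norm f ≠ ⊤) (a : α) : f a ≠ ⊤ := by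
  have h₁ : l2norm f ^ 2 ≠ ⊤ := ENNReal.pow_ne_top h
  rw [l2norm_sq] at h₁
  exact fun ha => ENNReal.ne_top_of_tsum_ne_top h₁ a (by simp [ha])

/-- The Cauchy-Schwarz inequality for three kernels. -/
theorem tsum_triangle_le (A : α → β → ℝ≥0∞) (B : β → γ → ℝ≥0∞) (C : α → γ → ℝ≥0∞) :
    ∑' a, ∑' b, ∑' c, A a b * B b c * C a c ≤
      l2norm (fun p : α × β => A p.1 p.2) * l2norm (fun p : β × γ => B p.1 p.2) *
        l2norm (fun p : α × γ => C p.1 p.2) := by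
  calc ∑' a, ∑' b, ∑' c, A a b * B b c * C a c
      = ∑' a, ∑' c, (∑' b, A a b * B b c) * C a c := by
        refine tsum_congr fun a => ?_
        rw [ENNReal.tsum_comm]
        simp only [ENNReal.tsum_mul_right]
    _ ≤ ∑' a, ∑' c, (l2norm (A a) * l2norm fun b => B b c) * C a c := by
        gcongr
        exact tsum_mul_le_l2norm_mul _ _
    _ = ∑' p : α × γ, (l2norm (A p.1) * l2norm fun b => B b p.2) * C p.1 p.2 := by
        rw [ENNReal.tsum_prod']
    _ ≤ l2norm (fun p : α × γ => l2norm (A p.1) * l2norm fun b => B b p.2) *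
          l2norm fun p : α × γ => C p.1 p.2 := tsum_mul_le_l2norm_mul _ _
    _ = _ := by
        rw [l2norm_mul (fun a => l2norm (A a)) (fun c => l2norm fun b => B b c), l2norm_prod,
          l2norm_prod, ← l2norm_comp_equiv (Equiv.prodComm β γ)]
        rfl

end L2Norm

/-! ### Convolution bounds and their equivalence with operator norm bounds. -/

section ConvolutionBound

/-- `‖x * ξ‖₂ ≤ K ‖x‖₂ ‖ξ‖₂` for nonnegative functions `x` supported on `S` and `ξ`, written as an
inequality of trilinear forms. -/
def ConvolutionBound {G : Type*} [Group G] (S : Set G) (K : ℝ≥0∞) : Prop :=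
  ∀ x ξ η : G → ℝ≥0∞, (∀ g, x g ≠ 0 → g ∈ S) →
    ∑' g, ∑' h, x g * ξ h * η (g * h) ≤ K * l2norm x * l2norm ξ * l2norm η

theorem ConvolutionBound.of_bijective {A B : Type*} [Group A] [Group B] {S : Set B} {K : ℝ≥0∞}
    (h : ConvolutionBound S K) (φ : A →* B) (hφ : Function.Bijective φ) :
    ConvolutionBound (φ ⁻¹' S) K := by
  intro x ξ η hx
  let e := MulEquiv.ofBijective φ hφ
  have key := h (x ∘ e.symm) (ξ ∘ e.symm) (η ∘ e.symm) (by
    intro b hb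
    have := hx _ hb
    rwa [Set.mem_preimage, show φ (e.symm b) = b from e.apply_symm_apply b] at this)
  have hn : ∀ f : A → ℝ≥0∞, l2norm (f ∘ e.symm) = l2norm f :=
    fun f => l2norm_comp_equiv e.symm.toEquiv f
  rw [hn, hn, hn] at key
  refine le_trans (le_of_eq ?_) key
  refine Eq.trans (tsum_congr fun a => ?_) (e.toEquiv.tsum_eq fun g => ∑' h,
    (x ∘ e.symm) g * (ξ ∘ e.symm) h * (η ∘ e.symm) (g * h))
  refine Eq.trans (tsum_congr fun b => ?_) (e.toEquiv.tsum_eq fun h =>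
    (x ∘ e.symm) (e a) * (ξ ∘ e.symm) h * (η ∘ e.symm) (e a * h))
  simp

/-- The bound for `T` applies in the second coordinate with the first ones fixed; the bound for `S`
then applies to the norms of the fibres. -/
theorem ConvolutionBound.prod {A B : Type*} [Group A] [Group B] {S : Set A} {T : Set B}
    {K L : ℝ≥0∞} (hS : ConvolutionBound S K) (hT : ConvolutionBound T L) :
    ConvolutionBound (S ×ˢ T) (K * L) := by
  intro x ξ η hx
  have hx₁ : ∀ a, l2norm (fun b => x (a, b)) ≠ 0 → a ∈ S := by
    intro a ha
    by_contra hS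
    refine ha (l2norm_eq_of_sq ?_)
    have : ∀ b, x (a, b) = 0 := fun b => by
      by_contra h
      exact hS (hx _ h).1
    simp [this]
  have hn : ∀ f : A × B → ℝ≥0∞, l2norm (fun a => l2norm fun b => f (a, b)) = l2norm f :=
    fun f => l2norm_prod fun a b => f (a, b)
  calc ∑' g, ∑' h, x g * ξ h * η (g * h)
      = ∑' a, ∑' a', ∑' b, ∑' b', x (a, b) * ξ (a', b') * η (a * a', b * b') := by
        rw [ENNReal.tsum_prod']
        refine tsum_congr fun a => ?_
        refine Eq.trans (tsum_congr fun b => ?_) ENNReal.tsum_comm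
        rw [ENNReal.tsum_prod']
        rfl
    _ ≤ ∑' a, ∑' a', L * l2norm (fun b => x (a, b)) * l2norm (fun b => ξ (a', b)) *
          l2norm (fun b => η (a * a', b)) := by
        gcongr with a a'
        exact hT _ _ _ fun b hb => (hx _ hb).2
    _ = L * ∑' a, ∑' a', l2norm (fun b => x (a, b)) * l2norm (fun b => ξ (a', b)) *
          l2norm (fun b => η (a * a', b)) := by
        simp only [mul_assoc, ENNReal.tsum_mul_left]
    _ ≤ L * (K * l2norm x * l2norm ξ * l2norm η) := by
        gcongr
        have := hS (fun a => l2norm fun b => x (a, b)) (fun a => l2norm fun b => ξ (a, b))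
          (fun a => l2norm fun b => η (a, b)) hx₁
        rwa [hn, hn, hn] at this
    _ = _ := by ring

theorem ConvolutionBound.pi {V : Type v} [Fintype V] :
    ∀ {G : V → Type w} [∀ i, Group (G i)] {S : ∀ i, Set (G i)} {K : V → ℝ≥0∞},
      (∀ i, ConvolutionBound (S i) (K i)) →
      ConvolutionBound {s : ∀ i, G i | ∀ i, s i ∈ S i} (∏ i, K i) := by
  refine Fintype.induction_empty_option (P := fun V _ =>
    ∀ {G : V → Type w} [∀ i, Group (G i)] {S : ∀ i, Set (G i)} {K : V → ℝ≥0∞},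
      (∀ i, ConvolutionBound (S i) (K i)) →
      ConvolutionBound {s : ∀ i, G i | ∀ i, s i ∈ S i} (∏ i, K i)) ?_ ?_ ?_ V
  · intro α β _ e ih G _ S K h
    let _ : Fintype α := Fintype.ofEquiv β e.symm
    have key := ih (G := fun a => G (e a)) fun a => h (e a)
    let φ : (∀ b, G b) →* ∀ a, G (e a) :=
      { toFun := fun s a => s (e a), map_one' := rfl, map_mul' := fun _ _ => rfl }
    have hφ : Function.Bijective φ := (Equiv.piCongrLeft' G e.symm).bijective
    have := key.of_bijective φ hφ
    rw [Fintype.prod_equiv e (fun a => K (e a)) K fun _ => rfl] at this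
    convert this using 1
    ext s
    exact (e.forall_congr_right (q := fun b => s b ∈ S b)).symm
  · intro G _ S K _ x ξ η _
    have ht : ∀ f : (∀ i, G i) → ℝ≥0∞, ∑' i, f i = f default := fun f =>
      tsum_eq_single default fun b hb => absurd (Subsingleton.elim b _) hb
    have h : ∀ f : (∀ i, G i) → ℝ≥0∞, l2norm f = f default := fun f =>
      l2norm_eq_of_sq (ht _)
    rw [h, h, h, ht, ht]
    simp [Subsingleton.elim (default * default : ∀ i, G i) default]
  · intro α _ ih G _ S K h
    have key := (h none).prod (ih (G := fun a => G (some a)) fun a => h (some a))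
    let φ : (∀ b, G b) →* G none × ∀ a, G (some a) :=
      { toFun := fun s => (s none, fun a => s (some a)), map_one' := rfl,
        map_mul' := fun _ _ => rfl }
    have hφ : Function.Bijective φ := by
      refine ⟨fun s t hst => ?_, fun p => ⟨fun o => o.rec p.1 p.2, rfl⟩⟩
      obtain ⟨h₁, h₂⟩ := Prod.mk.inj hst
      funext o
      cases o with
      | none => exact h₁
      | some a => exact congrFun h₂ a
    have := key.of_bijective φ hφ
    rw [Fintype.prod_option]
    convert this using 1
    ext s
    exact Option.forall

theorem tsum_conv_eq {G : Type*} [Group G] (x ξ η : G → ℝ≥0∞) :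
    ∑' g, ∑' h, x g * ξ h * η (g * h) = ∑' u, η u * ∑' g, x g * ξ (g⁻¹ * u) := by
  have h₁ : ∀ g, ∑' h, x g * ξ h * η (g * h) = ∑' u, η u * (x g * ξ (g⁻¹ * u)) := fun g => by
    rw [← (Equiv.mulLeft g).tsum_eq fun u => η u * (x g * ξ (g⁻¹ * u))]
    exact tsum_congr fun h => by simp [mul_comm]
  simp only [h₁]
  rw [ENNReal.tsum_comm]
  simp only [ENNReal.tsum_mul_left]

theorem enorm_eq_l2norm {G : Type u} (ξ : L2 G) : ‖ξ‖ₑ = l2norm fun g => ‖ξ g‖ₑ := by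
  refine (l2norm_eq_of_sq ?_).symm
  have h := lp.norm_rpow_eq_tsum (p := 2) (by norm_num) ξ
  have hs := (lp.memℓp ξ).summable (by norm_num)
  simp only [ENNReal.toReal_ofNat, Real.rpow_ofNat] at h hs
  rw [← ofReal_norm, ← ENNReal.ofReal_pow (norm_nonneg _), h,
    ENNReal.ofReal_tsum_of_nonneg (fun _ => by positivity) hs]
  exact tsum_congr fun g => by rw [ENNReal.ofReal_pow (norm_nonneg _), ofReal_norm]

theorem regularRep_apply {G : Type u} [Group G] (x : MonoidAlgebra ℂ G) (ξ : L2 G) (u : G) :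
    (regularRep x ξ : G → ℂ) u = ∑ g ∈ x.coeff.support, x.coeff g * ξ (g⁻¹ * u) := by
  rw [regularRep, sum_apply, lp.coeFn_sum, Finset.sum_apply]
  rfl

theorem ofReal_twoNorm {G : Type u} (x : MonoidAlgebra ℂ G) :
    ENNReal.ofReal (twoNorm x) = l2norm fun g => ‖x.coeff g‖ₑ := by
  refine (l2norm_eq_of_sq ?_).symm
  rw [twoNorm, ← ENNReal.ofReal_pow (Real.sqrt_nonneg _),
    Real.sq_sqrt (Finset.sum_nonneg fun _ _ => by positivity),
    ENNReal.ofReal_sum_of_nonneg fun _ _ => by positivity, tsum_eq_sum (s := x.coeff.support)]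
  · exact Finset.sum_congr rfl fun g _ => by
      rw [ENNReal.ofReal_pow (norm_nonneg _), ofReal_norm]
  · intro g hg
    simp [Finsupp.notMem_support_iff.1 hg]

/-- The form is tested on absolute values with `η = |λ(x) ξ|`, and one factor `‖λ(x) ξ‖` is
cancelled. -/
theorem ConvolutionBound.opNorm_le {G : Type u} [Group G] {S : Set G} {K : ℝ≥0}
    (h : ConvolutionBound S K) {x : MonoidAlgebra ℂ G} (hx : ∀ g ∈ x.coeff.support, g ∈ S) :
    opNorm x ≤ K * twoNorm x := by
  refine ContinuousLinearMap.opNorm_le_bound _ (by unfold twoNorm; positivity) fun ξ => ?_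
  set y := regularRep x ξ with hy
  have key : ‖y‖ₑ * ‖y‖ₑ ≤ K * ENNReal.ofReal (twoNorm x) * ‖ξ‖ₑ * ‖y‖ₑ := by
    calc ‖y‖ₑ * ‖y‖ₑ = ∑' u, ‖y u‖ₑ * ‖y u‖ₑ := by
          rw [enorm_eq_l2norm, ← sq, l2norm_sq]
          simp only [sq]
      _ ≤ ∑' u, ‖y u‖ₑ * ∑' g, ‖x.coeff g‖ₑ * ‖ξ (g⁻¹ * u)‖ₑ := by
          gcongr with u
          rw [hy, regularRep_apply]
          refine (enorm_sum_le _ _).trans ?_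
          simp only [enorm_mul]
          exact ENNReal.sum_le_tsum _
      _ ≤ K * (l2norm fun g => ‖x.coeff g‖ₑ) * (l2norm fun g => ‖ξ g‖ₑ) *
            l2norm fun g => ‖y g‖ₑ := by
          rw [← tsum_conv_eq (fun g => ‖x.coeff g‖ₑ) (fun g => ‖ξ g‖ₑ) fun g => ‖y g‖ₑ]
          exact h _ _ _ fun g hg => hx g (by simpa using hg)
      _ = _ := by rw [ofReal_twoNorm, enorm_eq_l2norm ξ, enorm_eq_l2norm y]
  by_cases hy0 : ‖y‖ₑ = 0
  · have : ‖y‖ = 0 := by simpa using hy0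
    rw [this]
    unfold twoNorm
    positivity
  · have h₁ := (ENNReal.mul_le_mul_iff_left hy0 enorm_ne_top).1 key
    have h₂ := ENNReal.toReal_mono (by finiteness) h₁
    simpa [ENNReal.toReal_mul, ENNReal.toReal_ofReal (Real.sqrt_nonneg _), twoNorm] using h₂

/-- Here `x` may have infinite support, so the hypothesis is applied to its truncations to finite
sets `A`. The condition `K ≠ 0` makes the right side infinite when `x` or `ξ` has infinite norm and
no norm vanishes. -/
theorem ConvolutionBound.of_opNorm_le {G : Type u} [Group G] {S : Set G} {K : ℝ≥0} (hK : K ≠ 0)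
    (h : ∀ x : MonoidAlgebra ℂ G, (∀ g ∈ x.coeff.support, g ∈ S) → opNorm x ≤ K * twoNorm x) :
    ConvolutionBound S K := by
  classical
  intro x ξ η hx
  by_cases hx0 : l2norm x = 0
  · simp [eq_zero_of_l2norm_eq_zero hx0]
  by_cases hξ0 : l2norm ξ = 0
  · simp [eq_zero_of_l2norm_eq_zero hξ0]
  by_cases hη0 : l2norm η = 0
  · simp [eq_zero_of_l2norm_eq_zero hη0]
  have hK' : (K : ℝ≥0∞) ≠ 0 := by simpa using hK
  by_cases hxt : l2norm x = ⊤
  · rw [hxt, ENNReal.mul_top hK', ENNReal.top_mul hξ0, ENNReal.top_mul hη0]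
    exact le_top
  by_cases hξt : l2norm ξ = ⊤
  · rw [hξt, ENNReal.mul_top (mul_ne_zero hK' hx0), ENNReal.top_mul hη0]
    exact le_top
  have hxf := apply_ne_top_of_l2norm_ne_top hxt
  have hξf := apply_ne_top_of_l2norm_ne_top hξt
  have henorm : ∀ a : ℝ≥0∞, a ≠ ⊤ → ‖((a.toReal : ℝ) : ℂ)‖ₑ = a := fun a ha => by
    rw [← ofReal_norm, Complex.norm_real, Real.norm_of_nonneg ENNReal.toReal_nonneg,
      ENNReal.ofReal_toReal ha]
  have hmem : Memℓp (fun g => (((ξ g).toReal : ℝ) : ℂ)) 2 := by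
    rw [memℓp_gen_iff (by norm_num)]
    have h₁ : ∑' g, ξ g ^ 2 ≠ ⊤ := by
      rw [← l2norm_sq]
      exact ENNReal.pow_ne_top hξt
    refine (ENNReal.summable_toReal h₁).congr fun g => ?_
    simp [ENNReal.toReal_pow]
  let ξ₀ : L2 G := ⟨_, hmem⟩
  have hξ₀ : ‖ξ₀‖ₑ = l2norm ξ := by
    rw [enorm_eq_l2norm]
    exact congrArg l2norm (funext fun g => henorm _ (hξf g))
  rw [ENNReal.tsum_eq_iSup_sum]
  refine iSup_le fun A => ?_
  let x₀ : MonoidAlgebra ℂ G := .ofCoeff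
    (Finsupp.onFinset A (fun g => if g ∈ A then (((x g).toReal : ℝ) : ℂ) else 0)
      fun g hg => by by_contra hA; simp [hA] at hg)
  have hx₀ : ∀ g, x₀.coeff g = if g ∈ A then (((x g).toReal : ℝ) : ℂ) else 0 := fun _ => rfl
  have hx₀e : ∀ g, ‖x₀.coeff g‖ₑ = if g ∈ A then x g else 0 := fun g => by
    rw [hx₀]
    split_ifs
    exacts [henorm _ (hxf g), enorm_zero]
  have hx₀s : x₀.coeff.support ⊆ A := fun g hg => by
    by_contra hA
    simp [hx₀, hA] at hg
  have hop : opNorm x₀ ≤ K * twoNorm x₀ := h x₀ fun g hg => hx g fun h0 => by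
    simp [hx₀, h0] at hg
  have h₁ : ∀ u, ‖regularRep x₀ ξ₀ u‖ₑ = ∑ g ∈ A, x g * ξ (g⁻¹ * u) := by
    intro u
    have : (regularRep x₀ ξ₀ : G → ℂ) u =
        (((∑ g ∈ A, x g * ξ (g⁻¹ * u)).toReal : ℝ) : ℂ) := by
      rw [regularRep_apply, Finset.sum_subset hx₀s fun g _ hg => by
        rw [Finsupp.notMem_support_iff.1 hg, zero_mul],
        ENNReal.toReal_sum fun g _ => ENNReal.mul_ne_top (hxf g) (hξf _), Complex.ofReal_sum]
      refine Finset.sum_congr rfl fun g hg => ?_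
      rw [hx₀, if_pos hg, ENNReal.toReal_mul, Complex.ofReal_mul]
    rw [this, henorm]
    exact ENNReal.sum_ne_top.2 fun g _ => ENNReal.mul_ne_top (hxf g) (hξf _)
  have h₂ : ‖regularRep x₀ ξ₀‖ₑ ≤ K * l2norm x * l2norm ξ := by
    calc ‖regularRep x₀ ξ₀‖ₑ ≤ ‖regularRep x₀‖ₑ * ‖ξ₀‖ₑ := by
          exact (regularRep x₀).le_opENorm ξ₀
      _ ≤ K * l2norm x * l2norm ξ := by
          rw [hξ₀]
          gcongr
          rw [← ofReal_norm]
          refine (ENNReal.ofReal_le_ofReal hop).trans ?_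
          rw [ENNReal.ofReal_mul K.coe_nonneg, ofReal_twoNorm, ENNReal.ofReal_coe_nnreal]
          gcongr
          refine le_of_sq_le ?_
          rw [l2norm_sq, l2norm_sq]
          gcongr with g
          rw [hx₀e]
          split_ifs
          exacts [le_rfl, zero_le]
  calc ∑ g ∈ A, ∑' h, x g * ξ h * η (g * h)
      = ∑' u, η u * ∑ g ∈ A, x g * ξ (g⁻¹ * u) := by
        have h₃ : ∀ g, ∑' h, x g * ξ h * η (g * h) = ∑' u, η u * (x g * ξ (g⁻¹ * u)) :=
          fun g => by
            rw [← (Equiv.mulLeft g).tsum_eq fun u => η u * (x g * ξ (g⁻¹ * u))]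
            exact tsum_congr fun h => by simp [mul_comm]
        simp only [h₃, Finset.mul_sum]
        rw [Summable.tsum_finsetSum fun _ _ => ENNReal.summable]
    _ ≤ l2norm η * l2norm fun u => ∑ g ∈ A, x g * ξ (g⁻¹ * u) := tsum_mul_le_l2norm_mul _ _
    _ = l2norm η * ‖regularRep x₀ ξ₀‖ₑ := by
        rw [enorm_eq_l2norm]
        simp only [h₁]
    _ ≤ l2norm η * (K * l2norm x * l2norm ξ) := by gcongr
    _ = _ := by ring

end ConvolutionBound

/-! ### The convolution bound for graph products. -/

section GraphProductBound

open GraphProduct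

variable {V : Type v} [Fintype V] {Γ : SimpleGraph V} {G : V → Type w} [∀ i, Group (G i)]
  {l : ∀ i, GroupSeminorm (G i)}

theorem ConvolutionBound.graphProduct {r : ℝ} {k : ℕ} {K : V → ℝ≥0∞}
    (hK : ∀ i, ConvolutionBound {g : G i | l i g ≤ r} (K i)) {S : Set (GraphProduct Γ G)}
    (hr : ∀ g ∈ S, length Γ l g ≤ r)
    (hk : ∀ e : List (Σ i, G i), Irred Γ e → eval Γ e ∈ S → e.length ≤ k) :
    ConvolutionBound S
      (((k + 1) ^ (2 * Fintype.card V) * Nat.card {Λ : List V // Λ.Nodup} : ℕ) * ∏ i, K i) := by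
  classical
  intro x ξ η hx
  let T := (V → Fin (k + 1)) × (V → Fin (k + 1)) × {Λ : List V // Λ.Nodup}
  -- For each type, `x`, `ξ` and `η` are written as functions of the factors of a splitting, and
  -- extended by `0`.
  let X : T → GraphProduct Γ G → GraphProduct Γ G → (∀ i, G i) → ℝ≥0∞ := fun τ a c s =>
    if IsSplitting Γ τ.2.2.1 (fun v => τ.1 v) a s c then
      x (a * (eval Γ (syllables τ.2.2.1 s) * c)) else 0
  let Y : T → GraphProduct Γ G → GraphProduct Γ G → (∀ i, G i) → ℝ≥0∞ := fun τ c b t =>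
    if IsSplitting Γ τ.2.2.1 (fun v => τ.2.1 v) c⁻¹ t b then
      ξ (c⁻¹ * (eval Γ (syllables τ.2.2.1 t) * b)) else 0
  let Z : T → GraphProduct Γ G → GraphProduct Γ G → (∀ i, G i) → ℝ≥0∞ := fun τ a b s =>
    if IsSplitting Γ τ.2.2.1 (fun v => τ.1 v) a s b then
      η (a * (eval Γ (syllables τ.2.2.1 s) * b)) else 0
  have hX : ∀ τ, l2norm (fun p : GraphProduct Γ G × GraphProduct Γ G => l2norm (X τ p.1 p.2)) ≤
      l2norm x := fun τ => by
    rw [l2norm_prod fun p : GraphProduct Γ G × GraphProduct Γ G => X τ p.1 p.2]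
    refine l2norm_indicator_comp_le
      (P := fun q : (GraphProduct Γ G × GraphProduct Γ G) × ∀ i, G i =>
        IsSplitting Γ τ.2.2.1 (fun v => τ.1 v) q.1.1 q.2 q.1.2)
      (φ := fun q => q.1.1 * (eval Γ (syllables τ.2.2.1 q.2) * q.1.2)) (fun q q' h h' he => ?_) x
    obtain ⟨h₁, h₂, h₃⟩ := h.unique h' he
    exact Prod.ext (Prod.ext h₁ h₃) h₂
  have hY : ∀ τ, l2norm (fun p : GraphProduct Γ G × GraphProduct Γ G => l2norm (Y τ p.1 p.2)) ≤
      l2norm ξ := fun τ => by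
    rw [l2norm_prod fun p : GraphProduct Γ G × GraphProduct Γ G => Y τ p.1 p.2]
    refine l2norm_indicator_comp_le
      (P := fun q : (GraphProduct Γ G × GraphProduct Γ G) × ∀ i, G i =>
        IsSplitting Γ τ.2.2.1 (fun v => τ.2.1 v) q.1.1⁻¹ q.2 q.1.2)
      (φ := fun q => q.1.1⁻¹ * (eval Γ (syllables τ.2.2.1 q.2) * q.1.2))
      (fun q q' h h' he => ?_) ξ
    obtain ⟨h₁, h₂, h₃⟩ := h.unique h' he
    exact Prod.ext (Prod.ext (inv_injective h₁) h₃) h₂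
  have hZ : ∀ τ, l2norm (fun p : GraphProduct Γ G × GraphProduct Γ G => l2norm (Z τ p.1 p.2)) ≤
      l2norm η := fun τ => by
    rw [l2norm_prod fun p : GraphProduct Γ G × GraphProduct Γ G => Z τ p.1 p.2]
    refine l2norm_indicator_comp_le
      (P := fun q : (GraphProduct Γ G × GraphProduct Γ G) × ∀ i, G i =>
        IsSplitting Γ τ.2.2.1 (fun v => τ.1 v) q.1.1 q.2 q.1.2)
      (φ := fun q => q.1.1 * (eval Γ (syllables τ.2.2.1 q.2) * q.1.2)) (fun q q' h h' he => ?_) η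
    obtain ⟨h₁, h₂, h₃⟩ := h.unique h' he
    exact Prod.ext (Prod.ext h₁ h₃) h₂
  let F : GraphProduct Γ G × GraphProduct Γ G → ℝ≥0∞ := fun p => x p.1 * ξ p.2 * η (p.1 * p.2)
  let H : T × GraphProduct Γ G × GraphProduct Γ G × GraphProduct Γ G × (∀ i, G i) × (∀ i, G i) →
      ℝ≥0∞ := fun q => X q.1 q.2.1 q.2.2.1 q.2.2.2.2.1 * Y q.1 q.2.2.1 q.2.2.2.1 q.2.2.2.2.2 *
        Z q.1 q.2.1 q.2.2.2.1 (q.2.2.2.2.1 * q.2.2.2.2.2)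
  let R : T × GraphProduct Γ G × GraphProduct Γ G × GraphProduct Γ G × (∀ i, G i) × (∀ i, G i) →
      GraphProduct Γ G × GraphProduct Γ G := fun q =>
    (q.2.1 * (eval Γ (syllables q.1.2.2.1 q.2.2.2.2.1) * q.2.2.1),
      q.2.2.1⁻¹ * (eval Γ (syllables q.1.2.2.1 q.2.2.2.2.2) * q.2.2.2.1))
  -- Each pair with `x p.1 ≠ 0` gets one type and one splitting. The pair is recovered by `R`, so
  -- the choice is injective and the form is at most the sum of `H` over all tuples.
  have hex : ∀ p : {p : GraphProduct Γ G × GraphProduct Γ G | x p.1 ≠ 0},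
      ∃ q, R q = p ∧ H q = F p := by
    rintro ⟨⟨g, h⟩, hg⟩
    have hgS := hx g hg
    obtain ⟨e, he, rfl⟩ := exists_irred g
    have hek := hk e he hgS
    obtain ⟨m, n, Λ, a, c, b, s, t, hm, hn, hΛ, h₁, h₂, h₃, h₄, h₅⟩ :=
      exists_splitting (eval Γ e) h he rfl
    have hprod : a * (eval Γ (syllables Λ (s * t)) * b) = eval Γ e * h := by
      rw [← h₁, ← h₂, eval_syllables_mul hΛ]
      group
    let τ : T := (fun v => ⟨m v, Nat.lt_succ_of_le ((hm v).trans hek)⟩,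
      fun v => ⟨n v, Nat.lt_succ_of_le ((hn v).trans hek)⟩,
      ⟨Λ, hΛ.imp fun h => h.ne⟩)
    refine ⟨(τ, a, c, b, s, t), Prod.ext h₁ h₂, ?_⟩
    have hX' : X τ a c s = x (eval Γ e) := by
      rw [← h₁]
      exact if_pos h₃
    have hY' : Y τ c b t = ξ h := by
      rw [← h₂]
      exact if_pos h₄
    have hZ' : Z τ a b (s * t) = η (eval Γ e * h) := by
      rw [← hprod]
      exact if_pos h₅
    simp only [H, F, hX', hY', hZ']
  choose Φ hΦR hΦH using hex
  have hΦ : Function.Injective Φ := fun p p' h =>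
    Subtype.ext (by rw [← hΦR p, ← hΦR p', h])
  -- A syllable is no longer than the element, so the `s` that occur lie in the product of the
  -- `r`-balls.
  have hsup : ∀ τ a c s, X τ a c s ≠ 0 → s ∈ {s : ∀ i, G i | ∀ i, s i ∈ {g : G i | l i g ≤ r}} := by
    intro τ a c s h i
    by_cases hs : IsSplitting Γ τ.2.2.1 (fun v => τ.1 v) a s c
    · refine (hs.le_length l i).trans (hr _ (hx _ ?_))
      simpa only [X, if_pos hs] using h
    · exact absurd (if_neg hs) h
  have hpi := ConvolutionBound.pi hK
  calc ∑' g, ∑' h, x g * ξ h * η (g * h) = ∑' p, F p := (ENNReal.tsum_prod' (f := F)).symm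
    _ = ∑' p : {p : GraphProduct Γ G × GraphProduct Γ G | x p.1 ≠ 0}, F p := by
        refine (tsum_subtype_eq_of_support_subset fun p hp => ?_).symm
        intro h
        exact hp (by simp [F, h])
    _ = ∑' p, H (Φ p) := tsum_congr fun p => (hΦH p).symm
    _ ≤ ∑' q, H q := ENNReal.tsum_comp_le_tsum_of_injective hΦ H
    _ = ∑' τ, ∑' a, ∑' c, ∑' b, ∑' s, ∑' t, X τ a c s * Y τ c b t * Z τ a b (s * t) := by
        simp only [ENNReal.tsum_prod', H]
    _ ≤ ∑' τ, ∑' a, ∑' c, ∑' b, (∏ i, K i) * l2norm (X τ a c) * l2norm (Y τ c b) *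
          l2norm (Z τ a b) := by
        gcongr with τ a c b
        exact hpi _ _ _ (hsup τ a c)
    _ = ∑' τ, (∏ i, K i) * ∑' a, ∑' c, ∑' b, l2norm (X τ a c) * l2norm (Y τ c b) *
          l2norm (Z τ a b) := by
        simp only [mul_assoc, ENNReal.tsum_mul_left]
    _ ≤ ∑' _ : T, (∏ i, K i) * (l2norm x * l2norm ξ * l2norm η) := by
        gcongr with τ
        refine (tsum_triangle_le (fun a c => l2norm (X τ a c)) (fun c b => l2norm (Y τ c b))
          fun a b => l2norm (Z τ a b)).trans ?_
        gcongr
        exacts [hX τ, hY τ, hZ τ]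
    _ = _ := by
        rw [tsum_fintype, Finset.sum_const, Finset.card_univ, nsmul_eq_mul]
        have : Fintype.card T =
            (k + 1) ^ (2 * Fintype.card V) * Nat.card {Λ : List V // Λ.Nodup} := by
          rw [Nat.card_eq_fintype_card]
          simp only [T, Fintype.card_prod, Fintype.card_fun, Fintype.card_fin]
          ring
        rw [this]
        ring

end GraphProductBound

/-! ### Subexponential functions. -/

section Subexponential

theorem IsSubexponential.mul {f g : ℕ → ℝ≥0} (hf : IsSubexponential f) (hg : IsSubexponential g) :
    IsSubexponential fun n => f n * g n := by
  have := Tendsto.mul hf hg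
  simpa only [IsSubexponential, NNReal.mul_rpow, mul_one] using this

theorem isSubexponential_const {c : ℝ≥0} (hc : c ≠ 0) : IsSubexponential fun _ => c := by
  have h := (tendsto_const_nhds (x := c)).nnrpow tendsto_one_div_atTop_nhds_zero_nat (Or.inl hc)
  rwa [NNReal.rpow_zero] at h

theorem IsSubexponential.pow {f : ℕ → ℝ≥0} (hf : IsSubexponential f) (k : ℕ) :
    IsSubexponential fun n => f n ^ k := by
  induction k with
  | zero => simpa using isSubexponential_const one_ne_zero
  | succ k ih => simpa only [pow_succ] using ih.mul hf

theorem IsSubexponential.prod {ι : Type*} (s : Finset ι) {f : ι → ℕ → ℝ≥0}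
    (hf : ∀ i, IsSubexponential (f i)) : IsSubexponential fun n => ∏ i ∈ s, f i n := by
  classical
  induction s using Finset.induction_on with
  | empty => simpa using isSubexponential_const one_ne_zero
  | insert i s hi ih => simpa only [Finset.prod_insert hi] using (hf i).mul ih

theorem IsSubexponential.one_max {f : ℕ → ℝ≥0} (hf : IsSubexponential f) :
    IsSubexponential fun n => max 1 (f n) := by
  have h := Tendsto.max (tendsto_const_nhds (x := (1 : ℝ≥0))) hf
  rw [max_self] at h
  refine h.congr fun n => ?_
  have := (NNReal.monotone_rpow_of_nonneg (z := 1 / (n : ℝ)) (by positivity)).map_max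
    (a := 1) (b := f n)
  simpa using this.symm

theorem IsSubexponential.of_le {f g : ℕ → ℝ≥0} (hg : IsSubexponential g) (h₁ : ∀ n, 1 ≤ f n)
    (h₂ : ∀ n, f n ≤ g n) : IsSubexponential f :=
  tendsto_of_tendsto_of_tendsto_of_le_of_le tendsto_const_nhds hg
    (fun n => NNReal.one_le_rpow (h₁ n) (by positivity))
    (fun n => NNReal.rpow_le_rpow (h₂ n) (by positivity))

theorem isSubexponential_add_one : IsSubexponential fun n => (n : ℝ≥0) + 1 := by
  -- The limit of `x ^ (1 / (x - 1))` is taken along `x = n + 1`, which leaves the exponent `1 / n`.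
  have h := (tendsto_rpow_div_mul_add 1 1 (-1) zero_ne_one).comp
    (tendsto_atTop_add_const_right atTop (1 : ℝ) tendsto_natCast_atTop_atTop)
  unfold IsSubexponential
  rw [← NNReal.tendsto_coe]
  refine h.congr fun n => ?_
  simp

theorem isSubexponential_linear (M : ℕ) : IsSubexponential fun n => (M : ℝ≥0) * n + 1 := by
  refine ((isSubexponential_const (c := (M : ℝ≥0) + 1) (by positivity)).mul
    isSubexponential_add_one).of_le (fun n => by simp) fun n => ?_
  have h₁ : (0 : ℝ≥0) ≤ M := zero_le
  have h₂ : (0 : ℝ≥0) ≤ n := zero_le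
  nlinarith

end Subexponential

/-! ### Decay for the graph product. -/

section Main

open GraphProduct

/-- The seminorm `1` is `0` at the identity and `1` elsewhere, so the balls of `l + 1` lie in those
of `l` and the same `f` works. -/
theorem HasSDWith.add_one {G : Type u} [Group G] [DecidableEq G] {l : GroupSeminorm G}
    (h : HasSDWith l) : HasSDWith (l + 1) := by
  obtain ⟨hc, f, hf, hd⟩ := h
  refine ⟨hc, f, hf, fun D x hx => hd D x fun g hg => le_trans ?_ (hx g hg)⟩
  rw [add_apply]
  exact le_add_of_nonneg_right (apply_nonneg _ _)

theorem HasSDWith.graphProduct {V : Type v} [Finite V] (Γ : SimpleGraph V) {G : V → Type w}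
    [∀ i, Group (G i)] {l : ∀ i, GroupSeminorm (G i)} (hl : ∀ i, HasSDWith (l i))
    (hc : ∀ i, ∃ c : ℝ, 0 < c ∧ ∀ g : G i, g ≠ 1 → c ≤ l i g) :
    HasSDWith (GraphProduct.length Γ l) := by
  classical
  have := Fintype.ofFinite V
  choose hcount f hf hd using hl
  choose c hc0 hc using hc
  obtain ⟨M, hM⟩ := Finite.exists_le fun i => ⌈1 / c i⌉₊
  -- A common lower bound `1 / (M + 1)` for nontrivial syllables gives at most `(M + 1) * D`
  -- syllables in the ball of radius `D`.
  have hMc : ∀ i, ∀ g : G i, g ≠ 1 → 1 / ((M : ℝ) + 1) ≤ l i g := fun i g hg => by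
    refine le_trans ?_ (hc i g hg)
    have h₁ : 1 / c i ≤ M := (Nat.le_ceil _).trans (by exact_mod_cast hM i)
    rw [div_le_comm₀ (by positivity) (hc0 i)]
    linarith
  have hC : Nat.card {Λ : List V // Λ.Nodup} ≠ 0 := by
    have : Nonempty {Λ : List V // Λ.Nodup} := ⟨⟨[], List.nodup_nil⟩⟩
    exact Nat.card_ne_zero.2 ⟨this, inferInstance⟩
  refine ⟨eval_surjective.countable, fun D => (((M + 1 : ℕ) : ℝ≥0) * D + 1) ^
    (2 * Fintype.card V) * (Nat.card {Λ : List V // Λ.Nodup} : ℝ≥0) * ∏ i, max 1 (f i D),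
    (((isSubexponential_linear _).pow _).mul (isSubexponential_const (by exact_mod_cast hC))).mul
      (IsSubexponential.prod _ fun i => (hf i).one_max), fun D x hx => ?_⟩
  -- The maximum with `1` provides the nonzero constant that `of_opNorm_le` requires.
  have hK : ∀ i, ConvolutionBound {g : G i | l i g ≤ D} ((max 1 (f i D) : ℝ≥0) : ℝ≥0∞) := by
    refine fun i => .of_opNorm_le (by positivity) fun y hy => (hd i D y hy).trans ?_
    gcongr
    · exact Real.sqrt_nonneg _
    · exact le_max_right _ _
  have key := ConvolutionBound.graphProduct (Γ := Γ) (k := (M + 1) * D) hK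
    (S := {g | GraphProduct.length Γ l g ≤ D}) (fun g hg => hg) (fun e he heD => by
      have h₁ := he.mul_length_le l hMc
      rw [← length_eval l he] at h₁
      have h₂ := h₁.trans heD
      rw [one_div, inv_mul_le_iff₀ (by positivity)] at h₂
      exact_mod_cast h₂)
  refine ConvolutionBound.opNorm_le (S := {g | GraphProduct.length Γ l g ≤ D}) ?_ hx
  convert key using 1
  push_cast
  rfl

end Main

end SubexpDecay

end

theorem mainTheorem6 {V : Type v} [Finite V] (Γ : SimpleGraph V) (G : V → Type w)
    [∀ i, Group (G i)] :
    ((∀ i, SubexpDecay.HasSD (G i)) → SubexpDecay.HasSD (SubexpDecay.GraphProduct Γ G)) ∧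
    (∀ l : ∀ i, GroupSeminorm (G i),
      (∀ i, SubexpDecay.HasSDWith (l i)) →
      (∀ i, ∃ c : ℝ, 0 < c ∧ ∀ g : G i, g ≠ 1 → c ≤ l i g) →
      ∃ L : GroupSeminorm (SubexpDecay.GraphProduct Γ G),
        (∀ e : List (Σ i, G i), SubexpDecay.GraphProduct.IsReduced Γ e →
          L (SubexpDecay.GraphProduct.eval Γ e) = (e.map fun y => l y.1 y.2).sum) ∧
        SubexpDecay.HasSDWith L) := by
  classical
  refine ⟨fun h => ?_, fun l hl hc => ⟨SubexpDecay.GraphProduct.length Γ l,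
    fun e he => SubexpDecay.GraphProduct.length_eval l he.irred, .graphProduct Γ hl hc⟩⟩
  choose l hl using h
  refine ⟨_, .graphProduct Γ (fun i => (hl i).add_one) fun i => ⟨1, one_pos, fun g hg => ?_⟩⟩
  rw [add_apply, GroupSeminorm.apply_one, if_neg hg]
  exact le_add_of_nonneg_left (apply_nonneg _ _)
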